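/- All Banach spaces are real. Fix, for each limit ordinal $\xi<\omega_1$, an increasing sequence $(\xi_n)_{n\ge 1}$ of ordinals below $\xi$ with $\lim_n\xi_n=\xi$. The Schreier families $\mathcal S_\xi$ $(0\le\xi<\omega_1)$ of finite subsets of $\mathbb N=\{1,2,\dots\}$ are defined by $\mathcal S_0=\{\emptyset\}\cup\{\{n\}:n\in\mathbb N\}$, $$\mathcal S_{\zeta+1}=\{\emptyset\}\cup\Big\{\bigcup_{i=1}^nF_i:\ n\ge1,\ n\le F_1<\dots<F_n,\ F_i\in\mathcal S_\zeta\Big\},\qquad \mathcal S_\xi=\bigcup_{n\ge1}\{F\in\mathcal S_{\xi_n}: n\le F\}\ \ (\xi\text{ a limit}).$$ For a Banach space $X$ let $\mathcal L(X)$ be the space of bounded linear operators $X\to X$, and $\mathcal{SS}(X)$ the set of strictly singular ones, that is, those whose restriction to any infinite dimensional subspace is not an isomorphism onto its image. For $1\le\xi<\omega_1$ let $\mathcal{SS}_\xi(X)$ be the set of $T\in\mathcal L(X)$ such that for every $\varepsilon>0$ and every normalized basic sequence $(x_n)_{n\ge 1}$ in $X$ there are $F\in\mathcal S_\xi$ and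 a nonzero $x\in[x_n]_{n\in F}$ with $\|Tx\|<\varepsilon\|x\|$. Put $$i(\mathcal{SS}(X))=\sup_{T\in\mathcal{SS}(X)}\inf\{\xi: 1\le\xi<\omega_1,\ T\in\mathcal{SS}_\xi(X)\}.$$ Let $\mathcal B(\mathcal L(X))=\{T\in\mathcal L(X):\|T\|\le1\}$, with the strong operator topology (pointwise convergence), and $\mathcal B(\mathcal{SS}(X))=\mathcal{SS}(X)\cap\mathcal B(\mathcal L(X))$. Call a Banach space $U$ a Pełczyński universal space if it has a normalized Schauder basis $(u_n)$ such that every normalized Schauder basis of a Banach space is equivalent to a subsequence $(u_{n_k})$ of $(u_n)$ whose closed linear span is complemented in $U$. (Such a space is unique up to isomorphism.) **Theorem.** A Pełczyński universal space exists; one realization is as follows. Let $\mathbb N_0=\{0,1,2,\dots\}$ and let $(x_n)_{n\in\mathbb N_0}$ be one fixed dense sequence in the unit sphere of $C(\{0,1\}^{\mathbb N_0})$. For a nonempty finite sequence $\sigma$ in $\mathbb N_0$ with last entry $n$, let $u_\sigma\in\ell_\infty(\mathbb N_0^{<\mathbb N_0};C(\{0,1\}^{\mathbb N_0}))$ take the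 value $x_n$ at all finite sequences having $\sigma$ as an initial segment, and $0$ elsewhere. The closed linear span of the $u_\sigma$ is a Pełczyński universal space. For every Pełczyński universal space $U$: 1. for every choice of the sequences $(\xi_n)$, every $T\in\mathcal{SS}(U)$ lies in $\mathcal{SS}_\xi(U)$ for some $1\le\xi<\omega_1$ (so that the infima in the index are over nonempty sets), and $i(\mathcal{SS}(U))=\omega_1$; 2. $\mathcal B(\mathcal{SS}(U))$ is a coanalytic subset of $\mathcal B(\mathcal L(U))$ which is not Borel, in the strong operator topology. -/

import Mathlib

open scoped Ordinal

noncomputable section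

/-! ### Schreier families -/

/-- A choice, for every countable limit ordinal `ξ`, of an increasing sequence of ordinals below `ξ`
which converges to `ξ`.  (The terms used below are `a ξ 1, a ξ 2, …`.) -/
def IsSchreierChoice (a : Ordinal.{0} → ℕ → Ordinal.{0}) : Prop :=
  ∀ ξ : Ordinal.{0}, Order.IsSuccLimit ξ → ξ < ω₁ →
    Monotone (a ξ) ∧ (∀ n, a ξ n < ξ) ∧ ∀ ζ < ξ, ∃ n, ζ < a ξ n

/-- The family `S₀`: the empty set and the singletons `{n}`, `n ≥ 1`. -/
def schreierZero : Set (Finset ℕ) :=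
  {F | F = ∅ ∨ ∃ n : ℕ, 1 ≤ n ∧ F = {n}}

/-- The successor step: all unions `F₁ ∪ ⋯ ∪ Fₙ` with `n ≥ 1`, all `Fᵢ ∈ S` and
`n ≤ F₁ < ⋯ < Fₙ` (together with the empty set). -/
def schreierSucc (S : Set (Finset ℕ)) : Set (Finset ℕ) :=
  {F | F = ∅ ∨ ∃ n : ℕ, 1 ≤ n ∧ ∃ G : Fin n → Finset ℕ,
    (∀ i, G i ∈ S) ∧
    (∀ i, ∀ k ∈ G i, n ≤ k) ∧
    (∀ i j, i < j → ∀ k ∈ G i, ∀ l ∈ G j, k < l) ∧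
    F = Finset.univ.biUnion G}

/-- The Schreier families `S_ξ`, by transfinite recursion, along a choice `a` of sequences converging
to limit ordinals.  They consist of finite subsets of `{1, 2, 3, …}`.  At a limit `ξ`, `S_ξ` is the
union over `n ≥ 1` of `{F ∈ S_{a ξ n} : n ≤ F}`. -/
def schreier (a : Ordinal.{0} → ℕ → Ordinal.{0}) (ξ : Ordinal.{0}) : Set (Finset ℕ) :=
  Ordinal.limitRecOn (motive := fun _ => Set (Finset ℕ)) ξ
    schreierZero
    (fun _ S => schreierSucc S)
    (fun ξ _ S => {F | ∃ n : ℕ, 1 ≤ n ∧ ∃ h : a ξ n < ξ, F ∈ S (a ξ n) h ∧ ∀ k ∈ F, n ≤ k})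

/-! ### Strictly singular operators and the index -/

section Operators

variable {X Y : Type*} [NormedAddCommGroup X] [NormedSpace ℝ X]
  [NormedAddCommGroup Y] [NormedSpace ℝ Y]

/-- `(x n)` is a basic sequence: it is a Schauder basis of its closed linear span. -/
def IsBasicSequence (x : ℕ → X) : Prop :=
  ∃ b : SchauderBasis ℝ (Submodule.span ℝ (Set.range x)).topologicalClosure,
    ∀ n, ((b n : (Submodule.span ℝ (Set.range x)).topologicalClosure) : X) = x n

/-- `T` is strictly singular: its restriction to an infinite dimensional subspace is never an
isomorphism onto its image, i.e. never bounded below. -/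
def IsStrictlySingular (T : X →L[ℝ] Y) : Prop :=
  ∀ Z : Submodule ℝ X, ¬ FiniteDimensional ℝ Z →
    ¬ ∃ c : ℝ, 0 < c ∧ ∀ z ∈ Z, c * ‖z‖ ≤ ‖T z‖

/-- `T` is `A`-strictly singular, for a family `A` of finite subsets of `{1, 2, 3, …}`.
A sequence `x₁, x₂, …` is given as `x : ℕ → X` with `x k` its term number `k + 1`. -/
def IsFamilyStrictlySingular (A : Set (Finset ℕ)) (T : X →L[ℝ] Y) : Prop :=
  ∀ ε : ℝ, 0 < ε → ∀ x : ℕ → X, IsBasicSequence x → (∀ n, ‖x n‖ = 1) →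
    ∃ F ∈ A, ∃ v ∈ Submodule.span ℝ (x '' {k | k + 1 ∈ F}), v ≠ 0 ∧ ‖T v‖ < ε * ‖v‖

/-- `T ∈ SS_ξ(X, Y)`: `T` is `S_ξ`-strictly singular. -/
def IsSchreierStrictlySingular (a : Ordinal.{0} → ℕ → Ordinal.{0}) (ξ : Ordinal.{0})
    (T : X →L[ℝ] Y) : Prop :=
  IsFamilyStrictlySingular (schreier a ξ) T

/-- `inf {ξ : T ∈ SS_ξ(X, Y)}`, over `1 ≤ ξ < ω₁`. -/
def strictlySingularRank (a : Ordinal.{0} → ℕ → Ordinal.{0}) (T : X →L[ℝ] Y) : Ordinal.{0} :=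
  sInf {ξ | 1 ≤ ξ ∧ ξ < ω₁ ∧ IsSchreierStrictlySingular a ξ T}

variable (X Y) in
/-- The index `i(SS(X, Y))`, the supremum over `T ∈ SS(X, Y)` of `inf {ξ : T ∈ SS_ξ(X, Y)}`. -/
def strictlySingularIndex (a : Ordinal.{0} → ℕ → Ordinal.{0}) : Ordinal.{0} :=
  ⨆ T : {T : X →L[ℝ] Y // IsStrictlySingular T}, strictlySingularRank a T.1

variable (X Y) in
/-- The closed unit ball `B(L(X, Y))` of the space of bounded operators. -/
def OperatorBall : Type _ := {T : X →L[ℝ] Y // ‖T‖ ≤ 1}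

/-- The strong operator topology (pointwise convergence) on `B(L(X, Y))`. -/
instance : TopologicalSpace (OperatorBall X Y) :=
  TopologicalSpace.induced (fun (T : OperatorBall X Y) (x : X) => T.1 x) inferInstance

variable (X Y) in
/-- `B(SS(X, Y))`, as a subset of `B(L(X, Y))`. -/
def strictlySingularBall : Set (OperatorBall X Y) :=
  {T | IsStrictlySingular T.1}

end Operators

/-! ### Pełczyński's universal space -/

/-- `U` has a normalized Schauder basis `(u n)` which is complementably universal: every normalized
Schauder basis `(e k)` of every Banach space `E` is equivalent to a subsequence `(u (φ k))` whose
closed linear span is complemented in `U`.  Here `J` is the isomorphism of `E` onto that closed span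
and `J ∘ Q` is a projection of `U` onto it.  (A space with a Schauder basis is separable, hence it
has a copy in `Type`.)  This property determines `U` up to isomorphism. -/
def IsPelczynskiUniversal (U : Type*) [NormedAddCommGroup U] [NormedSpace ℝ U] : Prop :=
  ∃ u : SchauderBasis ℝ U, (∀ n, ‖u n‖ = 1) ∧
    ∀ (E : Type) [NormedAddCommGroup E] [NormedSpace ℝ E] [CompleteSpace E]
      (e : SchauderBasis ℝ E), (∀ n, ‖e n‖ = 1) →
      ∃ φ : ℕ → ℕ, StrictMono φ ∧ ∃ (J : E →L[ℝ] U) (Q : U →L[ℝ] E),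
        (∀ k, J (e k) = u (φ k)) ∧ ∀ y, Q (J y) = y

/-- The space of continuous functions on the Cantor set. -/
abbrev CantorFunctions : Type := C(ℕ → Bool, ℝ)

instance : Nonempty (Metric.sphere (0 : CantorFunctions) 1) :=
  ⟨⟨1, by simp⟩⟩

/-- A sequence which is dense in the unit sphere of `C(Δ)`, `Δ` the Cantor set. -/
def cantorDense (n : ℕ) : CantorFunctions :=
  (TopologicalSpace.denseSeq (Metric.sphere (0 : CantorFunctions) 1) n : CantorFunctions)

theorem norm_cantorDense (n : ℕ) : ‖cantorDense n‖ = 1 := by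
  simp [cantorDense]

/-- The bounded functions from the tree of finite sequences of natural numbers to `C(Δ)`. -/
abbrev TreeFunctions : Type := lp (fun _ : List ℕ => CantorFunctions) ⊤

/-- The values of the tree vector at the nonempty node `s ++ [n]`: it takes the value `cantorDense n`
at all nodes which extend `s ++ [n]`, and `0` elsewhere. -/
def treeVectorFun (s : List ℕ) (n : ℕ) (t : List ℕ) : CantorFunctions :=
  open Classical in if s ++ [n] <+: t then cantorDense n else 0

theorem memℓp_treeVectorFun (s : List ℕ) (n : ℕ) :
    Memℓp (E := fun _ : List ℕ => CantorFunctions) (treeVectorFun s n) ⊤ := by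
  refine memℓp_infty ⟨1, ?_⟩
  rintro _ ⟨t, rfl⟩
  by_cases h : s ++ [n] <+: t <;> simp [treeVectorFun, h, norm_cantorDense]

/-- The tree vector at the node `s ++ [n]`, an element of `ℓ_∞(ℕ^{<ℕ}; C(Δ))`. -/
def treeVector (s : List ℕ) (n : ℕ) : TreeFunctions :=
  ⟨treeVectorFun s n, memℓp_treeVectorFun s n⟩

/-- Pełczyński's universal space, in Schechtman's realization: the closed linear span of the tree
vectors.  A finite combination `∑ c_σ u_σ` over nonempty nodes `σ` has as its norm the supremum over
the nodes `t` of `‖∑_{σ ≼ t} c_σ x_{last σ}‖`, where `(x n)` is dense in the unit sphere of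
`C(Δ)`. -/
abbrev PelczynskiSpace : Type :=
  ↥(Submodule.span ℝ (Set.range fun p : List ℕ × ℕ => treeVector p.1 p.2)).topologicalClosure

end

/-!
**Universality.**  Let `Δ` be the Cantor set, and let `(e k)` be a normalized basis of a Banach
space `E`.  By the Banach–Mazur theorem (`exists_isometric_embedding_cantorFunctions`) `E` is a
subspace of `C(Δ)`.  Approximating the `e k` by members `x (n k)` of the dense sequence gives a
branch of the tree, and `isPelczynskiUniversal_pelczynskiSpace` shows that the tree vectors on the
branch are equivalent to `(e k)` and span a complemented subspace.

**Countable indices and the upper bound of the complexity.**  Let `d` be a dense sequence in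
`U`.  An operator `T` has, for each `m`, the tree of the finite sets of indices on which `d` is
linearly independent and on whose span `T` is bounded below by `1 / m` (`IsBoundedBelowOn`).  By
small perturbations (`exists_perturbation`), `T` is strictly singular if and only if none of these
countably many trees has an infinite branch, and if `T` is not in `SS_ξ` then one of the trees
contains a copy of a tail of `S_ξ`.  A tree on a countable set with copies of tails of all `S_ξ`,
`ξ < ω₁`, has an infinite branch (`exists_branch_of_hasSchreierAbove`), so every strictly singular
`T` is in some `SS_ξ`.  The unit ball of operators is a Polish space for the strong operator
topology and the trees depend on `T` in a closed way, so the operators which are not strictly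
singular form an analytic set (`analyticSet_compl_strictlySingularBall`).

**Lower bounds.**  Let `𝓕` be a family of finite sets which contains the singletons, and let `X_𝓕`
be the completion of the finitely supported sequences with the norm
`sup_{F ∈ 𝓕} ∑_{n ∈ F} |x n|`.  The unit vectors are normalized bases of `ℓ₁` and of `X_𝓕`, so that both spaces are
complemented in `U`, and every `χ : ℕ → Bool` gives an operator on `U`, namely the multiplier
`x ↦ 1_χ x` from `ℓ₁` to `X_𝓕` (`IsPelczynskiUniversal.exists_multipliers`).  It is bounded below,
uniformly, on the spans of the members of `𝓕` contained in `χ`.  If the traces of the members of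
`𝓕` on `χ` form a compact family, it is strictly singular
(`EllOne.isStrictlySingular_of_isCompactFamily`): an infinite dimensional subspace of `ℓ₁`
contains almost disjoint normalized vectors, and by Mazur's theorem, in the form that pointwise
null bounded sequences in `C(K)` have uniformly small convex combinations, some convex combination
of these has a small image.

For the family of all finite pieces of branches of the tree of finite sequences, and `χ` a tree,
the multiplier is strictly singular if and only if `χ` has no infinite branch.  A diagonal argument
(`not_measurableSet_diagonal`) shows that this condition on `χ` is not Borel.  For the compact
family which has copies of all `S_ζ`, `ζ ≤ ξ`, in different columns of `ℕ × ℕ`, the multiplier is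
strictly singular and in none of the `SS_ζ`, so that the index is `ω₁`.
-/

/-! ### Basic sequences -/

section BasicSequences

open Filter Topology Finset

variable {X : Type*} [NormedAddCommGroup X] [NormedSpace ℝ X]

theorem exists_sum_range_eq_of_mem_span {x : ℕ → X} {v : X}
    (hv : v ∈ Submodule.span ℝ (Set.range x)) :
    ∃ (a : ℕ → ℝ) (N : ℕ), (∀ n, N ≤ n → a n = 0) ∧ v = ∑ i ∈ range N, a i • x i := by
  obtain ⟨c, rfl⟩ := Finsupp.mem_span_range_iff_exists_finsupp.1 hv
  have hN : ∀ i ∈ c.support, i < c.support.sup id + 1 := fun i hi =>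
    Nat.lt_succ_of_le (Finset.le_sup (f := id) hi)
  refine ⟨c, c.support.sup id + 1, fun n hn => ?_, ?_⟩
  · by_contra h
    have := hN n (Finsupp.mem_support_iff.2 h)
    omega
  · rw [Finsupp.sum]
    refine Finset.sum_subset (fun i hi => mem_range.2 (hN i hi)) fun i _ hi => ?_
    rw [Finsupp.notMem_support_iff.1 hi, zero_smul]

theorem sum_range_smul_eq_of_le {x : ℕ → X} {a : ℕ → ℝ} {N : ℕ} (ha : ∀ n, N ≤ n → a n = 0)
    {M : ℕ} (hM : N ≤ M) : ∑ i ∈ range M, a i • x i = ∑ i ∈ range N, a i • x i := by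
  refine (Finset.sum_subset (range_subset_range.2 hM) fun i _ hi => ?_).symm
  rw [ha i (by simpa using hi), zero_smul]

/-- The biorthogonal functionals of a sequence whose partial sum projections are bounded, extended
to the whole space by the Hahn–Banach theorem. -/
theorem exists_biorthogonal_of_norm_sum_le {x : ℕ → X} {K : ℝ} (hx : ∀ n, x n ≠ 0)
    (h : ∀ (a : ℕ → ℝ) (m n : ℕ), m ≤ n →
      ‖∑ i ∈ range m, a i • x i‖ ≤ K * ‖∑ i ∈ range n, a i • x i‖) :
    ∃ f : ℕ → StrongDual ℝ X, ∀ i j, f i (x j) = (Pi.single j (1 : ℝ) : ℕ → ℝ) i := by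
  have hcoef : ∀ (a : ℕ → ℝ) (N n : ℕ), n < N →
      |a n| ≤ 2 * K / ‖x n‖ * ‖∑ i ∈ range N, a i • x i‖ := by
    intro a N n hn
    have hpos : 0 < ‖x n‖ := norm_pos_iff.2 (hx n)
    rw [div_mul_eq_mul_div, le_div_iff₀ hpos]
    have h1 : a n • x n = ∑ i ∈ range (n + 1), a i • x i - ∑ i ∈ range n, a i • x i := by
      rw [sum_range_succ]; abel
    calc |a n| * ‖x n‖ = ‖a n • x n‖ := by rw [norm_smul, Real.norm_eq_abs]
      _ ≤ ‖∑ i ∈ range (n + 1), a i • x i‖ + ‖∑ i ∈ range n, a i • x i‖ := by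
          rw [h1]; exact norm_sub_le _ _
      _ ≤ 2 * K * ‖∑ i ∈ range N, a i • x i‖ := by
          linarith [h a (n + 1) N hn, h a n N hn.le]
  have hli : LinearIndependent ℝ x := by
    rw [linearIndependent_iff]
    intro l hl
    ext n
    have hN : ∀ i ∈ l.support, i < l.support.sup id + 1 := fun i hi =>
      Nat.lt_succ_of_le (Finset.le_sup (f := id) hi)
    have h0 : ∑ i ∈ range (max (l.support.sup id + 1) (n + 1)), l i • x i = 0 := by
      rw [← hl, Finsupp.linearCombination_apply, Finsupp.sum]
      refine (Finset.sum_subset (fun i hi => mem_range.2 ?_) fun i _ hi => ?_).symm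
      · exact (hN i hi).trans_le (le_max_left _ _)
      · rw [Finsupp.notMem_support_iff.1 hi, zero_smul]
    have := hcoef l (max (l.support.sup id + 1) (n + 1)) n
      (lt_of_lt_of_le (Nat.lt_succ_self n) (le_max_right _ _))
    rw [h0, norm_zero, mul_zero] at this
    simpa using this
  have hext : ∀ n, ∃ f : StrongDual ℝ X, ∀ j, f (x j) = (Pi.single j (1 : ℝ) : ℕ → ℝ) n := by
    intro n
    let B := Module.Basis.span hli
    have hB : ∀ j, B j = ⟨x j, Submodule.subset_span ⟨j, rfl⟩⟩ := fun j =>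
      Module.Basis.span_apply hli j
    let g : Submodule.span ℝ (Set.range x) →ₗ[ℝ] ℝ := B.coord n
    have hg : ∀ j, g (B j) = (Pi.single j (1 : ℝ) : ℕ → ℝ) n := by
      intro j
      simp [g, Finsupp.single_apply, Pi.single_apply, eq_comm]
    have hbound : ∀ v, ‖g v‖ ≤ 2 * K / ‖x n‖ * ‖v‖ := by
      intro v
      obtain ⟨a, N, ha, hv⟩ := exists_sum_range_eq_of_mem_span v.2
      have hM : N ≤ max N (n + 1) := le_max_left _ _
      rw [← sum_range_smul_eq_of_le ha hM] at hv
      have hv' : v = ∑ i ∈ range (max N (n + 1)), a i • B i := by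
        ext; simp [hB, hv]
      have hgv : g v = a n := by
        rw [hv', map_sum]
        simp only [map_smul, hg, Pi.single_apply, smul_eq_mul, mul_ite, mul_one, mul_zero]
        rw [Finset.sum_ite_eq, if_pos]
        exact mem_range.2 (lt_of_lt_of_le (Nat.lt_succ_self n) (le_max_right _ _))
      rw [hgv, Real.norm_eq_abs, Submodule.coe_norm, hv]
      exact hcoef a _ n (lt_of_lt_of_le (Nat.lt_succ_self n) (le_max_right _ _))
    obtain ⟨f, hf, -⟩ := exists_extension_norm_eq _ (g.mkContinuous _ hbound)
    refine ⟨f, fun j => ?_⟩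
    have := hf (B j)
    rw [LinearMap.mkContinuous_apply, hg] at this
    rw [← this, hB]
  choose f hf using hext
  exact ⟨f, hf⟩

/-- Grünblum's criterion. -/
theorem isBasicSequence_of_norm_sum_le {x : ℕ → X} {K : ℝ} (hx : ∀ n, x n ≠ 0)
    (h : ∀ (a : ℕ → ℝ) (m n : ℕ), m ≤ n →
      ‖∑ i ∈ range m, a i • x i‖ ≤ K * ‖∑ i ∈ range n, a i • x i‖) :
    IsBasicSequence x := by
  obtain ⟨f, hf⟩ := exists_biorthogonal_of_norm_sum_le hx h
  set S := Submodule.span ℝ (Set.range x) with hS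
  have hK : 0 ≤ K := by
    have h1 := h (fun _ => 1) 1 1 le_rfl
    simp only [one_smul, sum_range_one] at h1
    have hpos : 0 < ‖x 0‖ := norm_pos_iff.2 (hx 0)
    by_contra hneg
    have : K * ‖x 0‖ < 0 := mul_neg_of_neg_of_pos (not_le.1 hneg) hpos
    linarith
  have hfsum : ∀ (a : ℕ → ℝ) N i, i < N → f i (∑ j ∈ range N, a j • x j) = a i := by
    intro a N i hi
    rw [map_sum]
    simp only [map_smul, hf, Pi.single_apply, smul_eq_mul, mul_ite, mul_one, mul_zero]
    rw [Finset.sum_ite_eq, if_pos (mem_range.2 hi)]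
  have hPS : ∀ v ∈ S, ∃ N, ∀ n, N ≤ n → ∑ i ∈ range n, f i v • x i = v := by
    intro v hv
    obtain ⟨a, N, ha, hv⟩ := exists_sum_range_eq_of_mem_span hv
    refine ⟨N, fun n hn => ?_⟩
    rw [← sum_range_smul_eq_of_le ha hn] at hv
    rw [hv]
    exact sum_congr rfl fun i hi => by rw [hfsum a n i (mem_range.1 hi)]
  have hPbound : ∀ n, ∀ v ∈ S.topologicalClosure, ‖∑ i ∈ range n, f i v • x i‖ ≤ K * ‖v‖ := by
    intro n
    have hcl : IsClosed {v : X | ‖∑ i ∈ range n, f i v • x i‖ ≤ K * ‖v‖} :=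
      isClosed_le (by fun_prop) (by fun_prop)
    refine fun v hv => closure_minimal (fun w hw => ?_) hcl hv
    obtain ⟨N, hN⟩ := hPS w hw
    have h1 := h (fun i => f i w) n (max N n) (le_max_right _ _)
    rwa [hN _ (le_max_left _ _)] at h1
  have hlim : ∀ v ∈ S.topologicalClosure,
      Tendsto (fun n => ∑ i ∈ range n, f i v • x i) atTop (𝓝 v) := by
    intro v hv
    rw [Metric.tendsto_atTop]
    intro ε hε
    obtain ⟨w, hw, hvw⟩ := Metric.mem_closure_iff.1 hv (ε / (K + 1)) (by positivity)
    obtain ⟨N, hN⟩ := hPS w hw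
    refine ⟨N, fun n hn => ?_⟩
    have h1 := hPbound n (v - w) (sub_mem hv (S.le_topologicalClosure hw))
    have h2 : ∑ i ∈ range n, f i (v - w) • x i = ∑ i ∈ range n, f i v • x i - w := by
      simp only [map_sub, sub_smul, sum_sub_distrib]
      rw [hN n hn]
    rw [h2] at h1
    rw [dist_eq_norm] at hvw ⊢
    calc ‖∑ i ∈ range n, f i v • x i - v‖
        = ‖(∑ i ∈ range n, f i v • x i - w) - (v - w)‖ := by congr 1; abel
      _ ≤ K * ‖v - w‖ + ‖v - w‖ := (norm_sub_le _ _).trans (by linarith)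
      _ = (K + 1) * ‖v - w‖ := by ring
      _ < (K + 1) * (ε / (K + 1)) := by gcongr
      _ = ε := by field_simp
  refine ⟨{ basis := fun n => ⟨x n, S.le_topologicalClosure (Submodule.subset_span ⟨n, rfl⟩)⟩
            coord := fun n => (f n).comp S.topologicalClosure.subtypeL
            ortho := fun i j => by simp [hf, Pi.single_apply]
            expansion := fun v => ?_ }, fun n => rfl⟩
  rw [HasSum, SummationFilter.conditional_filter_eq_map_range, tendsto_map'_iff,
    tendsto_subtype_rng]
  refine (hlim v v.2).congr fun n => ?_
  simp

/-- The basis projections are uniformly bounded, by the uniform boundedness principle. -/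
theorem SchauderBasis.norm_sum_le [CompleteSpace X] (b : SchauderBasis ℝ X) :
    ∃ K : ℝ, 0 < K ∧ (∀ n v, ‖b.proj n v‖ ≤ K * ‖v‖) ∧ ∀ (a : ℕ → ℝ) (m n : ℕ), m ≤ n →
      ‖∑ i ∈ range m, a i • b i‖ ≤ K * ‖∑ i ∈ range n, a i • b i‖ := by
  obtain ⟨K, hK⟩ := b.exists_norm_proj_le
  have h1 : ∀ n v, ‖b.proj n v‖ ≤ (|K| + 1) * ‖v‖ := fun n v =>
    (b.proj n).le_of_opNorm_le ((hK n).trans ((le_abs_self K).trans (by linarith))) v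
  refine ⟨|K| + 1, by positivity, h1, fun a m n hmn => ?_⟩
  have h2 : ∑ i ∈ range m, a i • b i = b.proj m (∑ i ∈ range n, a i • b i) := by
    rw [map_sum]
    simp only [map_smul, SchauderBasis.proj_apply_basis_mem, smul_ite, smul_zero]
    rw [← Finset.sum_filter]
    refine sum_congr ?_ fun _ _ => rfl
    ext i
    simp only [mem_filter, mem_range]
    omega
  rw [h2]
  exact h1 m _

theorem SchauderBasis.isBasicSequence_comp [CompleteSpace X] (b : SchauderBasis ℝ X)
    {φ : ℕ → ℕ} (hφ : StrictMono φ) : IsBasicSequence fun k => b (φ k) := by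
  obtain ⟨K, -, hK, -⟩ := b.norm_sum_le
  refine isBasicSequence_of_norm_sum_le (K := K) (fun n => b.linearIndependent.ne_zero _) ?_
  intro a m n hmn
  have h2 : ∑ i ∈ range m, a i • b (φ i) = b.proj (φ m) (∑ i ∈ range n, a i • b (φ i)) := by
    rw [map_sum]
    simp only [map_smul, SchauderBasis.proj_apply_basis_mem, smul_ite, smul_zero, hφ.lt_iff_lt]
    rw [← Finset.sum_filter]
    refine sum_congr ?_ fun _ _ => rfl
    ext i
    simp only [mem_filter, mem_range]
    omega
  rw [h2]
  exact hK _ _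

theorem SchauderBasis.tendsto_sum [CompleteSpace X] (b : SchauderBasis ℝ X) (v : X) :
    Tendsto (fun n => ∑ i ∈ range n, b.coord i v • b i) atTop (𝓝 v) := by
  simpa using b.tendsto_proj v

/-- A basis dominates a sequence as soon as it does so on finite sums. -/
theorem SchauderBasis.exists_clm [CompleteSpace X] {Y : Type*} [NormedAddCommGroup Y]
    [NormedSpace ℝ Y] [CompleteSpace Y] (b : SchauderBasis ℝ X) (w : ℕ → Y) (C : ℝ)
    (h : ∀ (a : ℕ → ℝ) (n : ℕ), ‖∑ i ∈ range n, a i • w i‖ ≤ C * ‖∑ i ∈ range n, a i • b i‖) :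
    ∃ J : X →L[ℝ] Y, ∀ i, J (b i) = w i := by
  let J : ℕ → X →L[ℝ] Y := fun n => ∑ i ∈ range n, (b.coord i).smulRight (w i)
  have hJ : ∀ n v, J n v = ∑ i ∈ range n, b.coord i v • w i := fun n v => by simp [J]
  -- Difference of two partial sums is controlled by the same difference for the basis.
  have hdiff : ∀ v m n, m ≤ n → ‖J n v - J m v‖ ≤ C * ‖b.proj n v - b.proj m v‖ := by
    intro v m n hmn
    have e1 : J n v - J m v
        = ∑ i ∈ range n, (if m ≤ i then b.coord i v else 0) • w i := by
      rw [hJ, hJ, ← sum_range_add_sum_Ico _ hmn, add_sub_cancel_left]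
      simp only [ite_smul, zero_smul]
      rw [← Finset.sum_filter]
      refine sum_congr ?_ fun _ _ => rfl
      ext i; simp only [mem_filter, mem_range, mem_Ico]; omega
    have e2 : b.proj n v - b.proj m v
        = ∑ i ∈ range n, (if m ≤ i then b.coord i v else 0) • b i := by
      rw [b.proj_apply, b.proj_apply, ← sum_range_add_sum_Ico _ hmn, add_sub_cancel_left]
      simp only [ite_smul, zero_smul]
      rw [← Finset.sum_filter]
      refine sum_congr ?_ fun _ _ => rfl
      ext i; simp only [mem_filter, mem_range, mem_Ico]; omega
    rw [e1, e2]
    exact h _ n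
  have hC : ∀ v m n, ‖J n v - J m v‖ ≤ |C| * ‖b.proj n v - b.proj m v‖ := by
    intro v m n
    rcases le_total m n with hmn | hmn
    · exact (hdiff v m n hmn).trans (by gcongr; exact le_abs_self C)
    · rw [norm_sub_rev, norm_sub_rev (b.proj n v)]
      exact (hdiff v n m hmn).trans (by gcongr; exact le_abs_self C)
  have hcauchy : ∀ v, ∃ y, Tendsto (fun n => J n v) atTop (𝓝 y) := by
    intro v
    refine cauchySeq_tendsto_of_complete ?_
    have hc := (b.tendsto_proj v).cauchySeq
    rw [Metric.cauchySeq_iff] at hc ⊢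
    intro ε hε
    obtain ⟨N, hN⟩ := hc (ε / (|C| + 1)) (by positivity)
    refine ⟨N, fun m hm n hn => ?_⟩
    have h1 := hN m hm n hn
    rw [dist_eq_norm] at h1 ⊢
    calc ‖J m v - J n v‖ ≤ |C| * ‖b.proj m v - b.proj n v‖ := hC v n m
      _ ≤ (|C| + 1) * ‖b.proj m v - b.proj n v‖ := by gcongr; linarith
      _ < (|C| + 1) * (ε / (|C| + 1)) := by gcongr
      _ = ε := by field_simp
  choose F hF using hcauchy
  refine ⟨continuousLinearMapOfTendsto J (tendsto_pi_nhds.2 hF), fun i => ?_⟩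
  change F (b i) = w i
  refine tendsto_nhds_unique (hF (b i)) (tendsto_const_nhds.congr' ?_)
  filter_upwards [eventually_gt_atTop i] with n hn
  rw [hJ]
  simp only [b.ortho, Pi.single_apply, ite_smul, one_smul, zero_smul]
  rw [Finset.sum_ite_eq', if_pos (mem_range.2 hn)]

/-- Small perturbations: if the coefficients `a i` are at most `C i * B` and `x i - y i` is small
compared with `C i`, then replacing `x` by `y` changes the sums by at most `η * B`. -/
theorem norm_sum_smul_sub_le {x y : ℕ → X} {C : ℕ → ℝ} {η B : ℝ} (hC : ∀ i, 0 ≤ C i)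
    (hη : 0 ≤ η) (hB : 0 ≤ B)
    (hxy : ∀ i, ‖x i - y i‖ ≤ η * (1 / 2) ^ (i + 1) / (C i + 1))
    {s : Finset ℕ} {a : ℕ → ℝ} (ha : ∀ i ∈ s, |a i| ≤ C i * B) :
    ‖∑ i ∈ s, a i • x i - ∑ i ∈ s, a i • y i‖ ≤ η * B := by
  rw [← sum_sub_distrib]
  have hgeo : ∑ i ∈ s, (1 / 2 : ℝ) ^ (i + 1) ≤ 1 := by
    have h1 : HasSum (fun i : ℕ => (1 / 2 : ℝ) ^ (i + 1)) 1 := by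
      simpa [pow_succ, mul_comm, div_eq_mul_inv] using hasSum_geometric_two.mul_left (1 / 2 : ℝ)
    exact sum_le_hasSum s (fun i _ => by positivity) h1
  calc ‖∑ i ∈ s, (a i • x i - a i • y i)‖
      ≤ ∑ i ∈ s, ‖a i • x i - a i • y i‖ := norm_sum_le _ _
    _ ≤ ∑ i ∈ s, η * B * (1 / 2 : ℝ) ^ (i + 1) := by
        refine sum_le_sum fun i hi => ?_
        have hp : 0 < C i + 1 := by linarith [hC i]
        rw [← smul_sub, norm_smul, Real.norm_eq_abs]
        calc |a i| * ‖x i - y i‖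
            ≤ (C i * B) * (η * (1 / 2) ^ (i + 1) / (C i + 1)) :=
              mul_le_mul (ha i hi) (hxy i) (norm_nonneg _) (mul_nonneg (hC i) hB)
          _ = (C i / (C i + 1)) * (η * B * (1 / 2 : ℝ) ^ (i + 1)) := by ring
          _ ≤ 1 * (η * B * (1 / 2 : ℝ) ^ (i + 1)) := by
              gcongr
              rw [div_le_one hp]; linarith
          _ = η * B * (1 / 2 : ℝ) ^ (i + 1) := one_mul _
    _ ≤ η * B := by
        rw [← mul_sum]
        exact mul_le_of_le_one_right (by positivity) hgeo

theorem SchauderBasis.separableSpace [CompleteSpace X] (b : SchauderBasis ℝ X) :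
    TopologicalSpace.SeparableSpace X := by
  have h1 : TopologicalSpace.IsSeparable (Submodule.span ℝ (Set.range b) : Set X) :=
    (Set.countable_range b).isSeparable.span
  have h2 : closure (Submodule.span ℝ (Set.range b) : Set X) = Set.univ := by
    refine Set.eq_univ_of_forall fun v => mem_closure_of_tendsto (b.tendsto_sum v) ?_
    exact Eventually.of_forall fun n => Submodule.sum_mem _ fun i _ =>
      Submodule.smul_mem _ _ (Submodule.subset_span ⟨i, rfl⟩)
  have h3 := h1.closure
  rw [h2] at h3
  exact TopologicalSpace.isSeparable_univ_iff.1 h3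

end BasicSequences

/-! ### The tree space is universal -/

section PelczynskiSpace

open Filter Topology Finset

/-- The `k`-th nonempty node of the tree, in an enumeration in which every node comes after all its
initial segments: lists are coded by numbers so that a proper suffix has a smaller code, and nodes
are read backwards. -/
def treeNode (k : ℕ) : List ℕ :=
  (Denumerable.ofNat (List ℕ) k.unpair.2).reverse ++ [k.unpair.1]

/-- The tree vector at the `k`-th node. -/
noncomputable def treeBasisVector (k : ℕ) : TreeFunctions :=
  treeVector (Denumerable.ofNat (List ℕ) k.unpair.2).reverse k.unpair.1

/-- The number of the node `s ++ [n]`. -/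
def treeIndex (s : List ℕ) (n : ℕ) : ℕ := Nat.pair n (Encodable.encode s.reverse)

theorem treeNode_treeIndex (s : List ℕ) (n : ℕ) : treeNode (treeIndex s n) = s ++ [n] := by
  simp [treeNode, treeIndex]

theorem treeBasisVector_treeIndex (s : List ℕ) (n : ℕ) :
    treeBasisVector (treeIndex s n) = treeVector s n := by
  simp [treeBasisVector, treeIndex]

theorem encode_reverse_treeNode (k : ℕ) : Encodable.encode (treeNode k).reverse = k + 1 := by
  simp [treeNode]

theorem encode_le_of_suffix {l l' : List ℕ} (h : l <:+ l') :
    Encodable.encode l ≤ Encodable.encode l' := by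
  obtain ⟨r, rfl⟩ := h
  induction r with
  | nil => simp
  | cons a r ih =>
    rw [List.cons_append, Encodable.encode_list_cons]
    exact (ih.trans (Nat.right_le_pair _ _)).trans (Nat.le_succ _)

theorem le_of_treeNode_prefix {j k : ℕ} (h : treeNode j <+: treeNode k) : j ≤ k := by
  have := encode_le_of_suffix (List.reverse_suffix.2 h)
  rw [encode_reverse_treeNode, encode_reverse_treeNode] at this
  omega

theorem treeNode_injective : Function.Injective treeNode := fun _ _ h =>
  le_antisymm (le_of_treeNode_prefix (h ▸ List.prefix_rfl))
    (le_of_treeNode_prefix (h ▸ List.prefix_rfl))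

theorem range_treeBasisVector :
    Set.range treeBasisVector = Set.range fun p : List ℕ × ℕ => treeVector p.1 p.2 := by
  ext v
  constructor
  · rintro ⟨k, rfl⟩
    exact ⟨(_, _), rfl⟩
  · rintro ⟨p, rfl⟩
    exact ⟨_, treeBasisVector_treeIndex p.1 p.2⟩

open Classical in
theorem treeBasisVector_apply (k : ℕ) (t : List ℕ) :
    treeBasisVector k t = if treeNode k <+: t then cantorDense k.unpair.1 else 0 := rfl

open Classical in
theorem sum_treeBasisVector_apply (a : ℕ → ℝ) (s : Finset ℕ) (t : List ℕ) :
    (∑ i ∈ s, a i • treeBasisVector i : TreeFunctions) t =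
      ∑ i ∈ s with treeNode i <+: t, a i • cantorDense i.unpair.1 := by
  rw [lp.coeFn_sum, Finset.sum_apply, Finset.sum_filter]
  refine sum_congr rfl fun i _ => ?_
  rw [lp.coeFn_smul, Pi.smul_apply, treeBasisVector_apply, smul_ite, smul_zero]

theorem norm_treeBasisVector (k : ℕ) : ‖treeBasisVector k‖ = 1 := by
  classical
  refine le_antisymm (lp.norm_le_of_forall_le zero_le_one fun t => ?_) ?_
  · rw [treeBasisVector_apply]
    split_ifs <;> simp [norm_cantorDense]
  · have := lp.norm_apply_le_norm ENNReal.top_ne_zero (treeBasisVector k) (treeNode k)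
    rwa [treeBasisVector_apply, if_pos List.prefix_rfl, norm_cantorDense] at this

/-- The tree vectors form a monotone basic sequence: the value at a node `t` above the `m`-th node
of a sum of the first `m` tree vectors is also its value at the parent of the `m`-th node. -/
theorem norm_sum_treeBasisVector_le (a : ℕ → ℝ) {m n : ℕ} (hmn : m ≤ n) :
    ‖∑ i ∈ range m, a i • treeBasisVector i‖ ≤ ‖∑ i ∈ range n, a i • treeBasisVector i‖ := by
  classical
  refine monotone_nat_of_le_succ (f := fun n => ‖∑ i ∈ range n, a i • treeBasisVector i‖)
    (fun m => ?_) hmn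
  refine lp.norm_le_of_forall_le (norm_nonneg _) fun t => ?_
  obtain ⟨p, hp⟩ : ∃ p, (∑ i ∈ range m, a i • treeBasisVector i : TreeFunctions) t
      = (∑ i ∈ range (m + 1), a i • treeBasisVector i : TreeFunctions) p := by
    by_cases ht : treeNode m <+: t
    · obtain ⟨p, x, hpx⟩ : ∃ p x, treeNode m = p ++ [x] := ⟨_, _, rfl⟩
      refine ⟨p, ?_⟩
      rw [sum_treeBasisVector_apply, sum_treeBasisVector_apply]
      refine sum_congr ?_ fun _ _ => rfl
      have hpm : p <+: treeNode m := ⟨[x], hpx.symm⟩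
      ext i
      simp only [mem_filter, mem_range]
      constructor
      · rintro ⟨hi, hit⟩
        refine ⟨by omega, ?_⟩
        rcases List.prefix_or_prefix_of_prefix hit ht with h | h
        · rw [hpx, List.prefix_concat_iff, ← hpx] at h
          refine h.resolve_left fun h => ?_
          have := treeNode_injective h
          omega
        · have := le_of_treeNode_prefix h
          omega
      · rintro ⟨hi, hip⟩
        refine ⟨?_, (hip.trans hpm).trans ht⟩
        rcases Nat.lt_succ_iff_lt_or_eq.1 hi with h | rfl
        · exact h
        · have := hip.length_le
          rw [hpx] at this
          simp at this
    · refine ⟨t, ?_⟩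
      rw [sum_treeBasisVector_apply, sum_treeBasisVector_apply, range_add_one,
        Finset.filter_insert, if_neg ht]
  rw [hp]
  exact lp.norm_apply_le_norm ENNReal.top_ne_zero _ p

/-- In the enumeration which extends the order of the tree, the tree vectors are a Schauder basis of
their closed span. -/
theorem exists_schauderBasis_pelczynskiSpace :
    ∃ u : SchauderBasis ℝ PelczynskiSpace, ∀ n, (u n : TreeFunctions) = treeBasisVector n := by
  -- The basis is constructed over the span of `range treeBasisVector`, then the set is rewritten.
  have key : ∀ R : Set TreeFunctions, R = Set.range treeBasisVector →
      ∃ u : SchauderBasis ℝ (Submodule.span ℝ R).topologicalClosure,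
        ∀ n, ((u n : (Submodule.span ℝ R).topologicalClosure) : TreeFunctions)
          = treeBasisVector n := by
    rintro _ rfl
    refine isBasicSequence_of_norm_sum_le (K := 1) (fun n hn => ?_) fun a m n hmn => ?_
    · simpa [hn] using norm_treeBasisVector n
    · rw [one_mul]
      exact norm_sum_treeBasisVector_le a hmn
  exact key _ range_treeBasisVector.symm

/-- The Banach–Mazur theorem: a separable Banach space embeds isometrically into the continuous
functions on the Cantor set. -/
theorem exists_isometric_embedding_cantorFunctions (E : Type*) [NormedAddCommGroup E]
    [NormedSpace ℝ E] [TopologicalSpace.SeparableSpace E] :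
    ∃ i : E →L[ℝ] CantorFunctions, ∀ x, ‖i x‖ = ‖x‖ := by
  let K : Set (WeakDual ℝ E) := WeakDual.toStrongDual ⁻¹' Metric.closedBall 0 1
  have hK : IsCompact K := WeakDual.isCompact_closedBall 0 1
  have : TopologicalSpace.MetrizableSpace K := WeakDual.metrizable_of_isCompact ℝ E K hK
  let : MetricSpace K := TopologicalSpace.metrizableSpaceMetric K
  have : CompactSpace K := isCompact_iff_compactSpace.1 hK
  have : Nonempty K := ⟨⟨0, by simp [K]⟩⟩
  obtain ⟨g, hg, hgs⟩ := exists_nat_bool_continuous_surjective_of_compact K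
  have hle : ∀ s x, ‖(g s).1 x‖ ≤ ‖x‖ := by
    intro s x
    have h1 : ‖WeakDual.toStrongDual (g s).1‖ ≤ 1 := mem_closedBall_zero_iff.1 (g s).2
    simpa using (WeakDual.toStrongDual (g s).1).le_of_opNorm_le h1 x
  let L : E →ₗ[ℝ] CantorFunctions :=
    { toFun := fun x => ⟨fun s => (g s).1 x,
        (WeakDual.eval_continuous x).comp (continuous_subtype_val.comp hg)⟩
      map_add' := fun x y => by ext s; simp
      map_smul' := fun c x => by ext s; simp }
  have hL : ∀ x, ‖L x‖ ≤ 1 * ‖x‖ := fun x => by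
    rw [one_mul, ContinuousMap.norm_le _ (norm_nonneg _)]
    exact fun s => hle s x
  refine ⟨L.mkContinuous 1 hL, fun x => le_antisymm (by simpa using hL x) ?_⟩
  obtain ⟨f, hf, hfx⟩ := exists_dual_vector'' ℝ x
  obtain ⟨s, hs⟩ := hgs ⟨StrongDual.toWeakDual f, by simpa [K] using hf⟩
  have h1 := ContinuousMap.norm_coe_le_norm (L x) s
  have h2 : L x s = ‖x‖ := by
    change (g s).1 x = _
    rw [hs]
    exact hfx
  rw [h2, norm_norm] at h1
  exact h1

/-- A downward closed set of indices is, below `n`, an initial segment. -/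
theorem exists_forall_lt_iff_lt {p : ℕ → Prop} (hp : ∀ i, p (i + 1) → p i) (n : ℕ) :
    ∃ m, m ≤ n ∧ ∀ i, i < n → (p i ↔ i < m) := by
  classical
  induction n with
  | zero => exact ⟨0, le_rfl, fun i hi => absurd hi (Nat.not_lt_zero i)⟩
  | succ n ih =>
    obtain ⟨m, hmn, hm⟩ := ih
    by_cases hn : p n
    · have hall : ∀ k, k ≤ n → p (n - k) := by
        intro k
        induction k with
        | zero => exact fun _ => hn
        | succ k ihk =>
          intro hk
          refine hp _ ?_
          have : n - (k + 1) + 1 = n - k := by omega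
          rw [this]
          exact ihk (by omega)
      refine ⟨n + 1, le_rfl, fun i hi => ⟨fun _ => hi, fun _ => ?_⟩⟩
      have := hall (n - i) (by omega)
      rwa [show n - (n - i) = i by omega] at this
    · refine ⟨m, by omega, fun i hi => ?_⟩
      rcases Nat.lt_succ_iff_lt_or_eq.1 hi with h | rfl
      · exact hm i h
      · exact ⟨fun h => absurd h hn, fun h => by omega⟩

/-- The number of the node `(n 0, …, n k)` on the branch given by the sequence `n`. -/
def branchIndex (n : ℕ → ℕ) (k : ℕ) : ℕ := treeIndex ((List.range k).map n) (n k)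

theorem treeNode_branchIndex (n : ℕ → ℕ) (k : ℕ) :
    treeNode (branchIndex n k) = (List.range (k + 1)).map n := by
  rw [branchIndex, treeNode_treeIndex, List.range_succ, List.map_append, List.map_singleton]

theorem strictMono_branchIndex (n : ℕ → ℕ) : StrictMono (branchIndex n) := by
  refine strictMono_nat_of_lt_succ fun k => lt_of_le_of_ne (le_of_treeNode_prefix ?_) fun h => ?_
  · rw [treeNode_branchIndex, treeNode_branchIndex, List.range_succ (n := k + 1), List.map_append]
    exact List.prefix_append _ _
  · have := congrArg (fun j => (treeNode j).length) h
    simp [treeNode_branchIndex] at this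

theorem unpair_branchIndex (n : ℕ → ℕ) (k : ℕ) : (branchIndex n k).unpair.1 = n k := by
  simp [branchIndex, treeIndex]

theorem treeNode_prefix_branch {n : ℕ → ℕ} {j k : ℕ} :
    treeNode j <+: (List.range k).map n ↔ ∃ i < k, branchIndex n i = j := by
  constructor
  · intro h
    have hlen := h.length_le
    rw [List.length_map, List.length_range] at hlen
    have hpos : 0 < (treeNode j).length := by simp [treeNode]
    refine ⟨(treeNode j).length - 1, by omega, treeNode_injective ?_⟩
    rw [treeNode_branchIndex, Nat.sub_add_cancel hpos]
    rw [List.prefix_iff_eq_take] at h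
    rw [← List.map_take, List.take_range, min_eq_left hlen] at h
    exact h.symm
  · rintro ⟨i, hi, rfl⟩
    obtain ⟨d, rfl⟩ := Nat.exists_eq_add_of_le (Nat.succ_le_of_lt hi)
    rw [treeNode_branchIndex, @List.range_add (i + 1) d, List.map_append]
    exact List.prefix_append _ _

/-- The values of a sum of tree vectors along a branch are the partial sums of the corresponding
sum in `C(Δ)`. -/
theorem sum_treeBasisVector_apply_branch (n : ℕ → ℕ) (a : ℕ → ℝ) {k N : ℕ}
    (hk : ∀ i, branchIndex n i < N ↔ i < k) :
    (∑ i ∈ range N, a i • treeBasisVector i : TreeFunctions) ((List.range k).map n) =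
      ∑ i ∈ range k, a (branchIndex n i) • cantorDense (n i) := by
  classical
  rw [sum_treeBasisVector_apply]
  have h1 : {i ∈ range N | treeNode i <+: (List.range k).map n}
      = (range k).image (branchIndex n) := by
    ext j
    simp only [mem_filter, mem_range, mem_image, treeNode_prefix_branch]
    constructor
    · rintro ⟨-, h⟩
      exact h
    · rintro ⟨i, hi, rfl⟩
      exact ⟨(hk i).2 hi, i, hi, rfl⟩
  rw [h1, sum_image (strictMono_branchIndex n).injective.injOn]
  exact sum_congr rfl fun i _ => by rw [unpair_branchIndex]

/-- A normalized basis `(e k)` is embedded into `C(Δ)` and its vectors are approximated by a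
sequence `(x (n k))`, which is a branch of the tree.  The value at a node of a sum over the branch
is a partial sum, so the tree vectors on the branch are equivalent to `(e k)`.  The values of any
element along the branch depend on its coefficients there only, which gives the projection onto
the span of the branch. -/
theorem isPelczynskiUniversal_pelczynskiSpace : IsPelczynskiUniversal PelczynskiSpace := by
  classical
  obtain ⟨u, hu⟩ := exists_schauderBasis_pelczynskiSpace
  have hcoe : ∀ (s : Finset ℕ) (a : ℕ → ℝ) (φ : ℕ → ℕ),
      ((∑ i ∈ s, a i • u (φ i) : PelczynskiSpace) : TreeFunctions)
        = ∑ i ∈ s, a i • treeBasisVector (φ i) := by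
    intro s a φ
    simp [hu]
  refine ⟨u, fun n => ?_, ?_⟩
  · rw [Submodule.coe_norm, hu, norm_treeBasisVector]
  intro E _ _ _ e he
  have := e.separableSpace
  obtain ⟨ι, hι⟩ := exists_isometric_embedding_cantorFunctions E
  obtain ⟨K, hK, -, hKe⟩ := e.norm_sum_le
  -- A branch of the tree along which the `x n` are close to the images of the basis vectors.
  have hdense : ∀ k, ∃ n, ‖ι (e k) - cantorDense n‖
      ≤ 1 / 2 * (1 / 2) ^ (k + 1) / (‖e.coord k‖ + 1) := by
    intro k
    have hmem : ι (e k) ∈ Metric.sphere (0 : CantorFunctions) 1 := by simp [hι, he]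
    obtain ⟨n, hn⟩ := (TopologicalSpace.denseRange_denseSeq
      (Metric.sphere (0 : CantorFunctions) 1)).exists_dist_lt ⟨ι (e k), hmem⟩
      (ε := 1 / 2 * (1 / 2) ^ (k + 1) / (‖e.coord k‖ + 1)) (by positivity)
    refine ⟨n, ?_⟩
    rw [Subtype.dist_eq, dist_eq_norm] at hn
    exact hn.le
  choose n hn using hdense
  have hclose : ∀ (a : ℕ → ℝ) N, ‖ι (∑ i ∈ range N, a i • e i)
      - ∑ i ∈ range N, a i • cantorDense (n i)‖ ≤ 1 / 2 * ‖∑ i ∈ range N, a i • e i‖ := by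
    intro a N
    rw [map_sum]
    simp only [map_smul]
    refine norm_sum_smul_sub_le (C := fun i => ‖e.coord i‖) (fun i => norm_nonneg _) (by norm_num)
      (norm_nonneg _) hn fun i hi => ?_
    have h1 : e.coord i (∑ j ∈ range N, a j • e j) = a i := by
      rw [map_sum]
      simp only [map_smul, e.ortho, Pi.single_apply, smul_eq_mul, mul_ite, mul_one, mul_zero]
      rw [Finset.sum_ite_eq, if_pos hi]
    rw [← h1, ← Real.norm_eq_abs]
    exact (e.coord i).le_opNorm _
  have hupper : ∀ (a : ℕ → ℝ) N, ‖∑ i ∈ range N, a i • cantorDense (n i)‖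
      ≤ 2 * ‖∑ i ∈ range N, a i • e i‖ := by
    intro a N
    have h1 := norm_sub_norm_le (∑ i ∈ range N, a i • cantorDense (n i))
      (ι (∑ i ∈ range N, a i • e i))
    rw [norm_sub_rev, hι] at h1
    have h2 := hclose a N
    have h3 := norm_nonneg (∑ i ∈ range N, a i • e i)
    linarith
  have hlower : ∀ (a : ℕ → ℝ) N, ‖∑ i ∈ range N, a i • e i‖
      ≤ 2 * ‖∑ i ∈ range N, a i • cantorDense (n i)‖ := by
    intro a N
    have h1 := norm_sub_norm_le (ι (∑ i ∈ range N, a i • e i))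
      (∑ i ∈ range N, a i • cantorDense (n i))
    rw [hι] at h1
    have h2 := hclose a N
    linarith
  set φ := branchIndex n with hφ
  have hφm : StrictMono φ := strictMono_branchIndex n
  refine ⟨φ, hφm, ?_⟩
  obtain ⟨J, hJ⟩ := e.exists_clm (fun i => u (φ i)) (2 * K) (by
    intro a N
    rw [Submodule.coe_norm, hcoe]
    refine lp.norm_le_of_forall_le (by positivity) fun t => ?_
    obtain ⟨m, hmN, hm⟩ := exists_forall_lt_iff_lt (p := fun i => treeNode (φ i) <+: t) (by
      intro i hi
      refine List.IsPrefix.trans ?_ hi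
      rw [hφ, treeNode_branchIndex, treeNode_branchIndex, List.range_succ (n := i + 1),
        List.map_append]
      exact List.prefix_append _ _) N
    have hval : (∑ i ∈ range N, a i • treeBasisVector (φ i) : TreeFunctions) t
        = ∑ i ∈ range m, a i • cantorDense (n i) := by
      rw [lp.coeFn_sum, Finset.sum_apply]
      have : ∀ i ∈ range N, (a i • treeBasisVector (φ i) : TreeFunctions) t
          = if i < m then a i • cantorDense (n i) else 0 := by
        intro i hi
        rw [lp.coeFn_smul, Pi.smul_apply, treeBasisVector_apply, hφ, unpair_branchIndex]
        simp only [← hm i (mem_range.1 hi), smul_ite, smul_zero, hφ]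
      rw [sum_congr rfl this, ← Finset.sum_filter]
      refine sum_congr ?_ fun _ _ => rfl
      ext i
      simp only [mem_filter, mem_range]
      omega
    rw [hval]
    have h1 := hKe a m N hmN
    have h2 := hupper a m
    calc _ ≤ 2 * ‖∑ i ∈ range m, a i • e i‖ := h2
      _ ≤ 2 * (K * ‖∑ i ∈ range N, a i • e i‖) := by gcongr
      _ = _ := by ring)
  -- The projection: basis vectors off the branch are sent to `0`.
  obtain ⟨Q, hQ⟩ := u.exists_clm (Function.extend φ e 0) 2 (by
    intro a N
    obtain ⟨k, -, hk⟩ := exists_forall_lt_iff_lt (p := fun i => φ i < N)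
      (fun i hi => (hφm (Nat.lt_succ_self i)).trans hi) (N + 1)
    have hk' : ∀ i, φ i < N ↔ i < k := by
      intro i
      by_cases hi : i < N + 1
      · exact hk i hi
      · have h1 : i ≤ φ i := hφm.le_apply
        have h2 := hk N (Nat.lt_succ_self N)
        have h3 : N ≤ φ N := hφm.le_apply
        have h4 : ¬ N < k := fun h => by have := h2.2 h; omega
        constructor <;> intro <;> omega
    have hsum : ∑ j ∈ range N, a j • Function.extend φ e 0 j
        = ∑ i ∈ range k, a (φ i) • e i := by
      have h1 : ∑ i ∈ range k, a (φ i) • e i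
          = ∑ j ∈ (range k).image φ, a j • Function.extend φ e 0 j := by
        rw [sum_image hφm.injective.injOn]
        exact sum_congr rfl fun i _ => by rw [hφm.injective.extend_apply]
      rw [h1]
      refine (sum_subset (fun j hj => ?_) fun j hj hj' => ?_).symm
      · obtain ⟨i, hi, rfl⟩ := mem_image.1 hj
        exact mem_range.2 ((hk' i).2 (mem_range.1 hi))
      · rw [Function.extend_apply', Pi.zero_apply, smul_zero]
        rintro ⟨i, rfl⟩
        exact hj' (mem_image_of_mem _ (mem_range.2 ((hk' i).1 (mem_range.1 hj))))
    have hid := hcoe (range N) a id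
    simp only [id_eq] at hid
    rw [hsum, Submodule.coe_norm, hid]
    refine (hlower (fun i => a (φ i)) k).trans ?_
    rw [hφ, ← sum_treeBasisVector_apply_branch n a hk']
    gcongr
    exact lp.norm_apply_le_norm ENNReal.top_ne_zero _ _)
  refine ⟨J, Q, hJ, fun y => ?_⟩
  have h1 : Tendsto (fun N => Q (J (∑ i ∈ range N, e.coord i y • e i))) atTop (𝓝 (Q (J y))) :=
    ((Q.continuous.comp J.continuous).tendsto y).comp (e.tendsto_sum y)
  refine tendsto_nhds_unique h1 ((e.tendsto_sum y).congr fun N => ?_)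
  simp only [map_sum, map_smul, hJ, hQ, hφm.injective.extend_apply]

end PelczynskiSpace

/-! ### Schreier families -/

section Schreier

open Filter

variable {a : Ordinal.{0} → ℕ → Ordinal.{0}}

theorem schreier_zero : schreier a 0 = schreierZero := by
  rw [schreier, Ordinal.limitRecOn_zero]

theorem schreier_add_one (ξ : Ordinal.{0}) : schreier a (ξ + 1) = schreierSucc (schreier a ξ) := by
  rw [schreier, Ordinal.limitRecOn_add_one, schreier]

theorem mem_schreier_limit {ξ : Ordinal.{0}} (hξ : Order.IsSuccLimit ξ) {F : Finset ℕ} :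
    F ∈ schreier a ξ ↔
      ∃ n : ℕ, 1 ≤ n ∧ a ξ n < ξ ∧ F ∈ schreier a (a ξ n) ∧ ∀ k ∈ F, n ≤ k := by
  rw [schreier, Ordinal.limitRecOn_limit _ _ _ _ hξ]
  simp only [Set.mem_ofPred_eq, exists_prop, schreier]

theorem singleton_mem_schreier (ha : IsSchreierChoice a) {ξ : Ordinal.{0}} (hξ : ξ < ω₁)
    {k : ℕ} (hk : 1 ≤ k) : {k} ∈ schreier a ξ := by
  induction ξ using Ordinal.limitRecOn with
  | zero => rw [schreier_zero]; exact Or.inr ⟨k, hk, rfl⟩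
  | add_one ξ ih =>
    rw [schreier_add_one]
    refine Or.inr ⟨1, le_rfl, fun _ => {k}, fun _ => ih ((lt_add_one ξ).trans hξ), ?_, ?_, ?_⟩
    · simpa using hk
    · intro i j hij
      omega
    · simp
  | limit ξ hlim ih =>
    rw [mem_schreier_limit hlim]
    have h1 := (ha ξ hlim hξ).2.1 1
    exact ⟨1, le_rfl, h1, ih _ h1 (h1.trans hξ), by simpa using hk⟩

theorem empty_mem_schreier (ha : IsSchreierChoice a) {ξ : Ordinal.{0}} (hξ : ξ < ω₁) :
    ∅ ∈ schreier a ξ := by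
  induction ξ using Ordinal.limitRecOn with
  | zero => rw [schreier_zero]; exact Or.inl rfl
  | add_one ξ ih => rw [schreier_add_one]; exact Or.inl rfl
  | limit ξ hlim ih =>
    rw [mem_schreier_limit hlim]
    have h1 := (ha ξ hlim hξ).2.1 1
    exact ⟨1, le_rfl, h1, ih _ h1 (h1.trans hξ), by simp⟩

/-- One element can be put in front of a set in `S_ξ`, which gives a set in `S_{ξ+1}`: this is what
relates the index `ξ` to the height of trees. -/
theorem insert_mem_schreier_add_one (ha : IsSchreierChoice a) {ξ : Ordinal.{0}} (hξ : ξ < ω₁)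
    {k : ℕ} (hk : 2 ≤ k) {F : Finset ℕ} (hF : F ∈ schreier a ξ) (hkF : ∀ l ∈ F, k < l) :
    insert k F ∈ schreier a (ξ + 1) := by
  rw [schreier_add_one]
  refine Or.inr ⟨2, by norm_num, ![{k}, F], ?_, ?_, ?_, ?_⟩
  · simp [Fin.forall_fin_two, hF, singleton_mem_schreier ha hξ (one_le_two.trans hk)]
  · simp only [Fin.forall_fin_two, Matrix.cons_val_zero, Matrix.cons_val_one,
      Finset.mem_singleton, forall_eq]
    exact ⟨hk, fun l hl => hk.trans (hkF l hl).le⟩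
  · simp only [Fin.forall_fin_two]
    simpa using hkF
  · ext l
    simp [Fin.exists_fin_two]

/-- The Schreier families are almost increasing. -/
theorem exists_forall_mem_schreier_of_le (ha : IsSchreierChoice a) {ζ ξ : Ordinal.{0}}
    (hζ : ζ ≤ ξ) (hξ : ξ < ω₁) :
    ∃ N, ∀ F ∈ schreier a ζ, (∀ k ∈ F, N ≤ k) → F ∈ schreier a ξ := by
  induction ξ using Ordinal.limitRecOn with
  | zero => exact ⟨0, fun F hF _ => by rwa [nonpos_iff_eq_zero.1 hζ] at hF⟩
  | add_one ξ ih =>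
    rcases hζ.eq_or_lt with rfl | hlt
    · exact ⟨0, fun F hF _ => hF⟩
    obtain ⟨N, hN⟩ := ih (Order.lt_add_one_iff.1 hlt) ((lt_add_one ξ).trans hξ)
    refine ⟨max N 1, fun F hF hFN => ?_⟩
    rw [schreier_add_one]
    refine Or.inr ⟨1, le_rfl, fun _ => F, fun _ => hN F hF fun k hk => ?_, fun _ k hk => ?_, ?_, ?_⟩
    · exact (le_max_left _ _).trans (hFN k hk)
    · exact (le_max_right _ _).trans (hFN k hk)
    · intro i j hij
      omega
    · simp
  | limit ξ hlim ih =>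
    rcases hζ.eq_or_lt with rfl | hlt
    · exact ⟨0, fun F hF _ => hF⟩
    obtain ⟨hmono, hlt', hcof⟩ := ha ξ hlim hξ
    obtain ⟨n, hn⟩ := hcof ζ hlt
    have hn1 : ζ ≤ a ξ (max n 1) := hn.le.trans (hmono (le_max_left _ _))
    obtain ⟨N, hN⟩ := ih _ (hlt' (max n 1)) hn1 ((hlt' _).trans hξ)
    refine ⟨max N (max n 1), fun F hF hFN => ?_⟩
    rw [mem_schreier_limit hlim]
    exact ⟨max n 1, le_max_right _ _, hlt' _,
      hN F hF fun k hk => (le_max_left _ _).trans (hFN k hk),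
      fun k hk => (le_max_right _ _).trans (hFN k hk)⟩

/-- A family of finite sets is *compact* here if no infinite set has all its finite subsets
contained in members of the family.  For a hereditary family this says that its closure in
`{0, 1} ^ ℕ` consists of finite sets. -/
def IsCompactFamily (𝓕 : Set (Finset ℕ)) : Prop :=
  ∀ M : Set ℕ, M.Infinite → ∃ A : Finset ℕ, ↑A ⊆ M ∧ ∀ F ∈ 𝓕, ¬ A ⊆ F

/-- The unions of one member from each of finitely many compact families cannot contain all finite
subsets of an infinite set. -/
theorem exists_not_subset_biUnion {n : ℕ} {H : Fin n → Set (Finset ℕ)}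
    (hH : ∀ i, IsCompactFamily (H i)) {M : Set ℕ} (hM : M.Infinite) :
    ∃ A : Finset ℕ, ↑A ⊆ M ∧
      ∀ G : Fin n → Finset ℕ, (∀ i, G i ∈ H i) → ¬ A ⊆ Finset.univ.biUnion G := by
  by_contra! hcon
  let f := hM.natEmbedding
  have h1 : ∀ N : ℕ, ∃ G : Fin n → Finset ℕ, (∀ i, G i ∈ H i) ∧
      (Finset.range N).image (fun j => (f j : ℕ)) ⊆ Finset.univ.biUnion G := fun N =>
    hcon _ (by
      intro x hx
      obtain ⟨j, -, rfl⟩ := Finset.mem_image.1 (Finset.mem_coe.1 hx)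
      exact (f j).2)
  choose G hG hsub using h1
  -- Along an ultrafilter every element has a definite colour, the index of the set containing it.
  have h2 : ∀ j, ∃ i, ∀ᶠ N in (hyperfilter ℕ : Filter ℕ), (f j : ℕ) ∈ G N i := by
    intro j
    have h3 : ∀ᶠ N in (hyperfilter ℕ : Filter ℕ), ∃ i ∈ (Set.univ : Set (Fin n)),
        (f j : ℕ) ∈ G N i := by
      have h4 : ∀ᶠ N in (hyperfilter ℕ : Filter ℕ), j < N := by
        refine hyperfilter_le_cofinite ?_
        rw [Nat.cofinite_eq_atTop]
        exact eventually_gt_atTop j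
      filter_upwards [h4] with N hN
      have := hsub N (Finset.mem_image_of_mem _ (Finset.mem_range.2 hN))
      simpa using this
    rw [Ultrafilter.eventually_exists_mem_iff Set.finite_univ] at h3
    obtain ⟨i, -, hi⟩ := h3
    exact ⟨i, hi⟩
  choose c hc using h2
  obtain ⟨i, hi⟩ := Finite.exists_infinite_fiber c
  have hinf : ((fun j => (f j : ℕ)) '' (c ⁻¹' {i})).Infinite :=
    (Set.infinite_coe_iff.1 hi).image (Subtype.val_injective.comp f.injective).injOn
  obtain ⟨A, hA, hAF⟩ := hH i _ hinf
  have h5 : ∀ᶠ N in (hyperfilter ℕ : Filter ℕ), ∀ x ∈ A, x ∈ G N i := by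
    rw [Filter.eventually_all_finset]
    intro x hx
    obtain ⟨j, hj, rfl⟩ := hA hx
    have := hc j
    rwa [show c j = i from hj] at this
  obtain ⟨N, hN⟩ := h5.exists
  exact hAF _ (hG N i) hN

/-- Any element of an infinite set `M` bounds the number of pieces of a set in `S_{ξ+1}`
which contains it, and at a limit `ξ` it bounds the `n` for which the set can come from `S_{ξ_n}`.
-/
theorem isCompactFamily_schreier (ha : IsSchreierChoice a) {ξ : Ordinal.{0}} (hξ : ξ < ω₁) :
    IsCompactFamily (schreier a ξ) := by
  induction ξ using Ordinal.limitRecOn with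
  | zero =>
    intro M hM
    obtain ⟨A, hA, hcard⟩ := hM.exists_subset_card_eq 2
    refine ⟨A, hA, fun F hF hAF => ?_⟩
    have h1 := Finset.card_le_card hAF
    rw [schreier_zero] at hF
    rcases hF with rfl | ⟨n, -, rfl⟩
    · simp [hcard] at h1
    · simp [hcard] at h1
  | add_one ξ ih =>
    intro M hM
    have hξ' := (lt_add_one ξ).trans hξ
    obtain ⟨m, hm⟩ := hM.nonempty
    obtain ⟨A, hA, hAG⟩ := exists_not_subset_biUnion (n := m) (H := fun _ => schreier a ξ)
      (fun _ => ih hξ') hM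
    refine ⟨insert m A, ?_, fun F hF hAF => ?_⟩
    · rw [Finset.coe_insert]
      exact Set.insert_subset hm hA
    rw [schreier_add_one] at hF
    rcases hF with rfl | ⟨n, -, G, hG, hGn, -, rfl⟩
    · simp at hAF
    have hnm : n ≤ m := by
      obtain ⟨i, -, hi⟩ := Finset.mem_biUnion.1 (hAF (Finset.mem_insert_self m A))
      exact hGn i m hi
    refine hAG (fun i => if h : (i : ℕ) < n then G ⟨i, h⟩ else ∅) (fun i => ?_) fun x hx => ?_
    · split_ifs
      · exact hG _
      · exact empty_mem_schreier ha hξ'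
    · obtain ⟨i, -, hi⟩ := Finset.mem_biUnion.1 (hAF (Finset.mem_insert_of_mem hx))
      refine Finset.mem_biUnion.2 ⟨⟨i, i.2.trans_le hnm⟩, Finset.mem_univ _, ?_⟩
      simpa using hi
  | limit ξ hlim ih =>
    intro M hM
    obtain ⟨m, hm⟩ := hM.nonempty
    have hlt := (ha ξ hlim hξ).2.1
    obtain ⟨A, hA, hAG⟩ := exists_not_subset_biUnion (n := m + 1)
      (H := fun i => schreier a (a ξ i)) (fun i => ih _ (hlt i) ((hlt i).trans hξ)) hM
    refine ⟨insert m A, ?_, fun F hF hAF => ?_⟩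
    · rw [Finset.coe_insert]
      exact Set.insert_subset hm hA
    obtain ⟨n, -, -, hFn, hn⟩ := (mem_schreier_limit hlim).1 hF
    have hnm : n ≤ m := hn m (hAF (Finset.mem_insert_self m A))
    refine hAG (fun i => if (i : ℕ) = n then F else ∅) (fun i => ?_) fun x hx => ?_
    · split_ifs with h
      · rwa [h]
      · exact empty_mem_schreier ha ((hlt i).trans hξ)
    · refine Finset.mem_biUnion.2 ⟨⟨n, Nat.lt_succ_of_le hnm⟩, Finset.mem_univ _, ?_⟩
      simpa using hAF (Finset.mem_insert_of_mem hx)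

theorem countable_Iic_of_lt_omega_one {ξ : Ordinal.{0}} (hξ : ξ < ω₁) : (Set.Iic ξ).Countable := by
  rw [← Set.Iio_insert]
  refine Set.Countable.insert _ ?_
  rw [← Cardinal.le_aleph0_iff_set_countable, Cardinal.mk_Iio_ordinal, Cardinal.lift_le_aleph0,
    ← Order.lt_succ_iff, Cardinal.succ_aleph0]
  rwa [← Cardinal.ord_aleph, Cardinal.lt_ord] at hξ

end Schreier

/-! ### Trees of finite sets on which an operator is bounded below -/

section Perturbation

open Filter Topology Finset

variable {X : Type*} [NormedAddCommGroup X] [NormedSpace ℝ X]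

theorem exists_strongDual_eq_one_of_notMem {S : Submodule ℝ X} [FiniteDimensional ℝ S] {x : X}
    (hx : x ∉ S) : ∃ f : StrongDual ℝ X, f x = 1 ∧ ∀ v ∈ S, f v = 0 := by
  obtain ⟨g, hgx, hgS⟩ := S.exists_dual_map_eq_bot_of_notMem hx inferInstance
  have hxp : x ∈ S ⊔ Submodule.span ℝ {x} :=
    Submodule.mem_sup_right (Submodule.mem_span_singleton_self x)
  obtain ⟨f, hf, -⟩ := exists_extension_norm_eq (S ⊔ Submodule.span ℝ {x})
    (LinearMap.toContinuousLinearMap (g.comp (S ⊔ Submodule.span ℝ {x}).subtype))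
  have h1 : f x = g x := by simpa using hf ⟨x, hxp⟩
  refine ⟨(g x)⁻¹ • f, by simp [h1, hgx], fun v hv => ?_⟩
  have h2 : f v = g v := by simpa using hf ⟨v, Submodule.mem_sup_left hv⟩
  have h3 : g v = 0 := by
    have : g v ∈ Submodule.map g S := Submodule.mem_map_of_mem hv
    rwa [hgS, Submodule.mem_bot] at this
  simp [h2, h3]

/-- A finite codimensional subspace of an infinite dimensional space is not contained in a finite
dimensional one. -/
theorem exists_mem_ker_notMem {Y : Type*} [AddCommGroup Y] [Module ℝ Y] [FiniteDimensional ℝ Y]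
    {Z : Submodule ℝ X} (hZ : ¬ FiniteDimensional ℝ Z) (g : X →ₗ[ℝ] Y) (S : Submodule ℝ X)
    [FiniteDimensional ℝ S] : ∃ x ∈ Z, g x = 0 ∧ x ∉ S := by
  by_contra! h
  refine hZ ((Submodule.fg_iff_finiteDimensional Z).1 ?_)
  refine Submodule.fg_of_fg_map_of_fg_inf_ker g (IsNoetherian.noetherian _) ?_
  have hle : Z ⊓ LinearMap.ker g ≤ S := fun x hx => h x hx.1 hx.2
  exact (Submodule.fg_iff_finiteDimensional _).2 (Submodule.finiteDimensional_of_le hle)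

/-- An infinite dimensional subspace contains a sequence with biorthogonal functionals.  No basic
sequence is needed: bounded coordinates suffice for perturbing the sequence. -/
theorem exists_biorthogonal_mem {Z : Submodule ℝ X} (hZ : ¬ FiniteDimensional ℝ Z) :
    ∃ (x : ℕ → X) (f : ℕ → StrongDual ℝ X), (∀ n, x n ∈ Z) ∧
      ∀ i j, f i (x j) = if i = j then 1 else 0 := by
  classical
  obtain ⟨p, hp, hr⟩ := exists_seq_of_forall_finset_exists
    (fun p : X × StrongDual ℝ X => p.1 ∈ Z ∧ p.2 p.1 = 1)
    (fun p q => p.2 q.1 = 0 ∧ q.2 p.1 = 0) (by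
      intro s _
      let g : X →ₗ[ℝ] (s → ℝ) := LinearMap.pi fun p => (p.1.2 : X →ₗ[ℝ] ℝ)
      obtain ⟨x, hxZ, hxg, hxS⟩ := exists_mem_ker_notMem hZ g
        (Submodule.span ℝ ((s.image Prod.fst : Finset X) : Set X))
      obtain ⟨f, hf1, hf0⟩ := exists_strongDual_eq_one_of_notMem hxS
      refine ⟨(x, f), ⟨hxZ, hf1⟩, fun p hp => ⟨?_, ?_⟩⟩
      · exact congrFun hxg ⟨p, hp⟩
      · exact hf0 _ (Submodule.subset_span (Finset.mem_coe.2 (mem_image_of_mem _ hp))))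
  refine ⟨fun n => (p n).1, fun n => (p n).2, fun n => (hp n).1, fun i j => ?_⟩
  rcases lt_trichotomy i j with h | rfl | h
  · rw [if_neg h.ne]
    exact (hr i j h).1
  · rw [if_pos rfl]
    exact (hp i).2
  · rw [if_neg h.ne']
    exact (hr j i h).2

/-- For a sequence `d` of vectors, the finite sets of indices at which `d` is linearly independent
and on the span of which `T` is bounded below by `1 / m`.  With `d` dense these sets form, for a
given `m`, a tree on a countable set, and `T` is strictly singular if and only if none of these
trees has an infinite branch. -/
def IsBoundedBelowOn (d : ℕ → X) (T : X →L[ℝ] X) (m : ℕ) (t : Finset ℕ) : Prop :=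
  LinearIndepOn ℝ d t ∧
    ∀ c : ℕ → ℝ, ‖∑ i ∈ t, c i • d i‖ ≤ m * ‖T (∑ i ∈ t, c i • d i)‖

/-- The operator is bounded below on the span of the vectors of an infinite branch. -/
theorem not_isStrictlySingular_of_branch {d : ℕ → X} {T : X →L[ℝ] X} {m : ℕ} {y : ℕ → ℕ}
    (hy : Function.Injective y) (h : ∀ n, IsBoundedBelowOn d T m ((range n).image y)) :
    ¬ IsStrictlySingular T := by
  intro hT
  have hli : LinearIndependent ℝ (fun i => d (y i)) := by
    rw [linearIndependent_iff]
    intro l hl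
    ext k
    obtain ⟨N, hN⟩ : ∃ N, ∀ i ∈ insert k l.support, i < N :=
      ⟨(insert k l.support).sup id + 1, fun i hi =>
        Nat.lt_succ_of_le (Finset.le_sup (f := id) hi)⟩
    have h1 := linearIndepOn_finset_iff.1 (h N).1 (fun j => l (Function.invFun y j))
    rw [sum_image hy.injOn] at h1
    simp only [Function.leftInverse_invFun hy _] at h1
    have h2 : ∑ i ∈ range N, l i • d (y i) = 0 := by
      rw [← hl, Finsupp.linearCombination_apply, Finsupp.sum]
      refine (Finset.sum_subset (fun i hi => mem_range.2 (hN i (mem_insert_of_mem hi)))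
        fun i _ hi => ?_).symm
      rw [Finsupp.notMem_support_iff.1 hi, zero_smul]
    have h3 := h1 h2 (y k) (mem_image_of_mem _ (mem_range.2 (hN k (mem_insert_self _ _))))
    rwa [Function.leftInverse_invFun hy _] at h3
  refine hT (Submodule.span ℝ (Set.range fun i => d (y i))) (fun hfd => ?_)
    ⟨1 / (m + 1), by positivity, fun z hz => ?_⟩
  · have := (linearIndependent_span hli).finite_of_isNoetherian
    exact not_finite ℕ
  · obtain ⟨a, N, -, rfl⟩ := exists_sum_range_eq_of_mem_span hz
    have h1 := (h N).2 (fun j => a (Function.invFun y j))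
    rw [sum_image hy.injOn] at h1
    simp only [Function.leftInverse_invFun hy _] at h1
    rw [div_mul_eq_mul_div, one_mul, div_le_iff₀ (by positivity)]
    have := norm_nonneg (T (∑ i ∈ range N, a i • d (y i)))
    linarith

/-- A sequence with bounded coordinates can be moved into a dense set, without losing linear
independence or lower bounds for `T` on finite spans. -/
theorem exists_perturbation {d : ℕ → X} (hd : DenseRange d) (T : X →L[ℝ] X) {x : ℕ → X}
    {C : ℕ → ℝ} (hC : ∀ i, 0 ≤ C i)
    (hx : ∀ (s : Finset ℕ) (a : ℕ → ℝ), ∀ i ∈ s, |a i| ≤ C i * ‖∑ j ∈ s, a j • x j‖)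
    {ε : ℝ} (hε : 0 < ε) :
    ∃ y : ℕ → ℕ, Function.Injective y ∧ ∃ m : ℕ, ∀ F : Finset ℕ,
      (∀ a : ℕ → ℝ, ε * ‖∑ i ∈ F, a i • x i‖ ≤ ‖T (∑ i ∈ F, a i • x i)‖) →
        IsBoundedBelowOn d T m (F.image y) := by
  obtain ⟨η, hη0, hη1, hη2⟩ : ∃ η : ℝ, 0 < η ∧ η ≤ 1 / 2 ∧ ‖T‖ * η ≤ ε / 2 := by
    refine ⟨min (1 / 2) (ε / (2 * (‖T‖ + 1))), by positivity, min_le_left _ _, ?_⟩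
    calc ‖T‖ * min (1 / 2) (ε / (2 * (‖T‖ + 1)))
        ≤ (‖T‖ + 1) * (ε / (2 * (‖T‖ + 1))) := by
          gcongr
          · linarith
          · exact min_le_right _ _
      _ = ε / 2 := by field_simp
  have hclose : ∀ i, ∃ n, ‖x i - d n‖ ≤ η * (1 / 2) ^ (i + 1) / (C i + 1) := by
    intro i
    have : 0 < C i + 1 := by linarith [hC i]
    obtain ⟨n, hn⟩ := hd.exists_dist_lt (x i) (ε := η * (1 / 2) ^ (i + 1) / (C i + 1))
      (by positivity)
    exact ⟨n, by rw [← dist_eq_norm]; exact hn.le⟩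
  choose y hy using hclose
  have hsum : ∀ (s : Finset ℕ) (a : ℕ → ℝ), ‖∑ i ∈ s, a i • x i - ∑ i ∈ s, a i • d (y i)‖
      ≤ η * ‖∑ i ∈ s, a i • x i‖ := fun s a =>
    norm_sum_smul_sub_le hC hη0.le (norm_nonneg _) hy fun i hi => hx s a i hi
  have hindep : ∀ (s : Finset ℕ) (a : ℕ → ℝ), ∑ i ∈ s, a i • d (y i) = 0 → ∀ i ∈ s, a i = 0 := by
    intro s a h0 i hi
    have h1 := hsum s a
    rw [h0, sub_zero] at h1
    have h2 : ‖∑ i ∈ s, a i • x i‖ = 0 := by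
      have := norm_nonneg (∑ i ∈ s, a i • x i)
      nlinarith
    have h3 := hx s a i hi
    rw [h2, mul_zero] at h3
    exact abs_nonpos_iff.1 h3
  have hinj : Function.Injective y := by
    intro i j hij
    by_contra hne
    have h1 := hindep {i, j} (fun k => if k = i then 1 else -1) (by
      rw [sum_pair hne, if_pos rfl, if_neg (Ne.symm hne), hij]
      simp) i (mem_insert_self _ _)
    simp at h1
  -- The perturbation at most doubles the norm of the vector and at most halves the lower bound `ε`.
  refine ⟨y, hinj, ⌈4 / ε⌉₊, fun F hF => ⟨?_, fun c => ?_⟩⟩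
  · rw [linearIndepOn_finset_iff]
    intro c hc j hj
    obtain ⟨i, hi, rfl⟩ := mem_image.1 hj
    rw [sum_image hinj.injOn] at hc
    exact hindep F (fun i => c (y i)) hc i hi
  · rw [sum_image hinj.injOn]
    set v := ∑ i ∈ F, c (y i) • x i with hv
    set w := ∑ i ∈ F, c (y i) • d (y i) with hw
    have h1 : ‖v - w‖ ≤ η * ‖v‖ := hsum F fun i => c (y i)
    have h2 : ε * ‖v‖ ≤ ‖T v‖ := hF fun i => c (y i)
    have h3 : ‖T v‖ - ‖T w‖ ≤ ‖T‖ * (η * ‖v‖) := by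
      calc ‖T v‖ - ‖T w‖ ≤ ‖T v - T w‖ := norm_sub_norm_le _ _
        _ = ‖T (v - w)‖ := by rw [map_sub]
        _ ≤ ‖T‖ * ‖v - w‖ := T.le_opNorm _
        _ ≤ ‖T‖ * (η * ‖v‖) := by gcongr
    have h4 : ‖T‖ * (η * ‖v‖) ≤ ε / 2 * ‖v‖ := by
      rw [← mul_assoc]; gcongr
    have h5 : ‖w‖ ≤ 2 * ‖v‖ := by
      have h6 := norm_sub_norm_le w v
      rw [norm_sub_rev] at h6
      have h7 : η * ‖v‖ ≤ 1 / 2 * ‖v‖ := by gcongr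
      have := norm_nonneg v
      linarith
    have h8 : ‖w‖ ≤ 4 / ε * ‖T w‖ := by
      rw [div_mul_eq_mul_div, le_div_iff₀ hε]
      nlinarith
    exact h8.trans (by gcongr; exact Nat.le_ceil _)

/-- The coordinates of a basic sequence are bounded on finite sums. -/
theorem IsBasicSequence.exists_abs_le {x : ℕ → X} (hx : IsBasicSequence x) :
    ∃ C : ℕ → ℝ, (∀ i, 0 ≤ C i) ∧
      ∀ (s : Finset ℕ) (a : ℕ → ℝ), ∀ i ∈ s, |a i| ≤ C i * ‖∑ j ∈ s, a j • x j‖ := by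
  classical
  obtain ⟨b, hb⟩ := hx
  refine ⟨fun i => ‖b.coord i‖, fun i => norm_nonneg _, fun s a i hi => ?_⟩
  have h1 : b.coord i (∑ j ∈ s, a j • b j) = a i := by
    rw [map_sum]
    simp only [map_smul, b.ortho, Pi.single_apply, smul_eq_mul, mul_ite, mul_one, mul_zero]
    rw [Finset.sum_ite_eq, if_pos hi]
  have h2 := (b.coord i).le_opNorm (∑ j ∈ s, a j • b j)
  rw [h1, Submodule.coe_norm] at h2
  simpa [hb] using h2

theorem exists_branch_of_not_isStrictlySingular {d : ℕ → X} (hd : DenseRange d)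
    {T : X →L[ℝ] X} (hT : ¬ IsStrictlySingular T) :
    ∃ (m : ℕ) (y : ℕ → ℕ), Function.Injective y ∧
      ∀ n, IsBoundedBelowOn d T m ((range n).image y) := by
  rw [IsStrictlySingular] at hT
  push Not at hT
  obtain ⟨Z, hZ, c, hc, hcZ⟩ := hT
  obtain ⟨x, f, hxZ, hxf⟩ := exists_biorthogonal_mem hZ
  obtain ⟨y, hy, m, hm⟩ := exists_perturbation hd T (x := x) (C := fun i => ‖f i‖)
    (fun i => norm_nonneg _) (fun s a i hi => by
      have h1 : f i (∑ j ∈ s, a j • x j) = a i := by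
        rw [map_sum]
        simp only [map_smul, hxf, smul_eq_mul, mul_ite, mul_one, mul_zero]
        rw [Finset.sum_ite_eq, if_pos hi]
      rw [← Real.norm_eq_abs, ← h1]
      exact (f i).le_opNorm _) hc
  exact ⟨m, y, hy, fun n => hm _ fun a =>
    hcZ _ (Submodule.sum_mem _ fun i _ => Submodule.smul_mem _ _ (hxZ i))⟩

end Perturbation

/-! ### Copies of Schreier families in trees -/

section Index

open Filter Topology Finset

variable {X : Type*} [NormedAddCommGroup X] [NormedSpace ℝ X]
variable {a : Ordinal.{0} → ℕ → Ordinal.{0}}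

/-- The node `t` of the tree `P` has above it a copy of a tail of the Schreier family `S_ξ`. -/
def HasSchreierAbove (a : Ordinal.{0} → ℕ → Ordinal.{0}) (P : Finset ℕ → Prop) (ξ : Ordinal.{0})
    (t : Finset ℕ) : Prop :=
  ∃ (y : ℕ → ℕ) (N : ℕ), Set.InjOn y {k | N ≤ k} ∧ (∀ k, N ≤ k → y k ∉ t) ∧
    ∀ F ∈ schreier a ξ, (∀ k ∈ F, N ≤ k) → P (t ∪ F.image y)

theorem HasSchreierAbove.anti (ha : IsSchreierChoice a) {P : Finset ℕ → Prop} {ζ ξ : Ordinal.{0}}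
    (hζ : ζ ≤ ξ) (hξ : ξ < ω₁) {t : Finset ℕ} (h : HasSchreierAbove a P ξ t) :
    HasSchreierAbove a P ζ t := by
  obtain ⟨y, N, hy, hyt, hP⟩ := h
  obtain ⟨M, hM⟩ := exists_forall_mem_schreier_of_le ha hζ hξ
  exact ⟨y, max N M, hy.mono fun k (hk : max N M ≤ k) => (le_max_left N M).trans hk,
    fun k hk => hyt k ((le_max_left _ _).trans hk),
    fun F hF hFN => hP F (hM F hF fun k hk => (le_max_right _ _).trans (hFN k hk))
      fun k hk => (le_max_left _ _).trans (hFN k hk)⟩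

theorem HasSchreierAbove.exists_insert (ha : IsSchreierChoice a) {P : Finset ℕ → Prop}
    {ξ : Ordinal.{0}} (hξ : ξ < ω₁) {t : Finset ℕ} (h : HasSchreierAbove a P (ξ + 1) t) :
    ∃ n ∉ t, HasSchreierAbove a P ξ (insert n t) := by
  obtain ⟨y, N, hy, hyt, hP⟩ := h
  -- The new element has to be at least `2`, as the union of two sets must start after `2`.
  have hk : N ≤ max N 2 := le_max_left _ _
  refine ⟨y (max N 2), hyt _ hk, y, max N 2 + 1, hy.mono fun k hk' => ?_, fun k hk' => ?_,
    fun F hF hFN => ?_⟩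
  · exact hk.trans ((Nat.le_succ _).trans hk')
  · rw [mem_insert, not_or]
    refine ⟨fun heq => ?_, hyt k (hk.trans ((Nat.le_succ _).trans hk'))⟩
    have := hy (hk.trans ((Nat.le_succ _).trans hk')) hk heq
    omega
  · have h1 := hP _ (insert_mem_schreier_add_one ha hξ (le_max_right N 2) hF fun l hl =>
      hFN l hl) (by
        intro l hl
        rcases mem_insert.1 hl with rfl | hl
        · exact hk
        · exact hk.trans ((Nat.le_succ _).trans (hFN l hl)))
    rwa [image_insert, union_insert, ← insert_union] at h1

/-- A tree on a countable set which contains copies of tails of `S_ξ` for all `ξ < ω₁` has an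
infinite branch. -/
theorem exists_branch_of_hasSchreierAbove (ha : IsSchreierChoice a) {P : Finset ℕ → Prop}
    (h : ∀ ξ < ω₁, HasSchreierAbove a P ξ ∅) :
    ∃ y : ℕ → ℕ, Function.Injective y ∧ ∀ n, P ((range n).image y) := by
  -- If every successor of `t` failed at a countable ordinal, then `t` would fail at the successor
  -- of the supremum of these ordinals.
  have hstep : ∀ t : {t : Finset ℕ // ∀ ξ < ω₁, HasSchreierAbove a P ξ t},
      ∃ n ∉ t.1, ∀ ξ < ω₁, HasSchreierAbove a P ξ (insert n t.1) := by
    rintro ⟨t, ht⟩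
    by_contra! hcon
    have h1 : ∀ n, ∃ ξ < ω₁, n ∉ t → ¬ HasSchreierAbove a P ξ (insert n t) := by
      intro n
      by_cases hn : n ∈ t
      · exact ⟨0, Ordinal.omega_pos 1, fun h => absurd hn h⟩
      · obtain ⟨ξ, hξ, hξ'⟩ := hcon n hn
        exact ⟨ξ, hξ, fun _ => hξ'⟩
    choose ξ hξ hξn using h1
    have hsup : ⨆ n, ξ n < ω₁ := Ordinal.iSup_lt_omega_one hξ
    obtain ⟨n, hn, hn'⟩ := (ht _ ((Cardinal.isSuccLimit_omega 1).add_one_lt hsup)).exists_insert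
      ha hsup
    exact hξn n hn (hn'.anti ha (Ordinal.le_iSup ξ n) hsup)
  choose g hg hg' using hstep
  let t : ℕ → {t : Finset ℕ // ∀ ξ < ω₁, HasSchreierAbove a P ξ t} := fun n =>
    Nat.rec ⟨∅, h⟩ (fun _ s => ⟨insert (g s) s.1, hg' s⟩) n
  have htsucc : ∀ n, (t (n + 1)).1 = insert (g (t n)) (t n).1 := fun n => rfl
  have himage : ∀ n, (t n).1 = (range n).image fun k => g (t k) := by
    intro n
    induction n with
    | zero => rfl
    | succ n ih => rw [htsucc, ih, range_add_one, image_insert]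
  refine ⟨fun k => g (t k), ?_, fun n => ?_⟩
  · refine Function.Injective.of_lt_imp_ne fun i j hij heq => ?_
    refine hg (t j) ?_
    rw [himage j, ← heq]
    exact mem_image.2 ⟨i, mem_range.2 hij, rfl⟩
  · rw [← himage]
    obtain ⟨y, N, -, -, hP⟩ := (t n).2 0 (Ordinal.omega_pos 1)
    simpa using hP ∅ (empty_mem_schreier ha (Ordinal.omega_pos 1)) (by simp)

/-- If `T` fails to be `S_ξ`-strictly singular, a basic sequence which witnesses this can be
perturbed into a dense sequence and yields a copy of `S_ξ` in one of countably many trees.  These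
have no infinite branch when `T` is strictly singular, so the copies stop at some countable
ordinal. -/
theorem exists_isSchreierStrictlySingular [TopologicalSpace.SeparableSpace X]
    (ha : IsSchreierChoice a) {T : X →L[ℝ] X} (hT : IsStrictlySingular T) :
    ∃ ξ : Ordinal.{0}, 1 ≤ ξ ∧ ξ < ω₁ ∧ IsSchreierStrictlySingular a ξ T := by
  set d := TopologicalSpace.denseSeq X
  have hd : DenseRange d := TopologicalSpace.denseRange_denseSeq X
  have h1 : ∀ m : ℕ, ∃ ξ < ω₁, ¬ HasSchreierAbove a (IsBoundedBelowOn d T m) ξ ∅ := by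
    intro m
    by_contra! hcon
    obtain ⟨y, hy, hP⟩ := exists_branch_of_hasSchreierAbove ha hcon
    exact not_isStrictlySingular_of_branch hy hP hT
  choose ξ hξ hξm using h1
  have hsup : max 1 (⨆ m, ξ m) < ω₁ :=
    max_lt (Ordinal.one_lt_omega0.trans Ordinal.omega0_lt_omega_one)
      (Ordinal.iSup_lt_omega_one hξ)
  refine ⟨max 1 (⨆ m, ξ m), le_max_left _ _, hsup, fun ε hε x hx _ => ?_⟩
  by_contra! hcon
  obtain ⟨C, hC, hxC⟩ := hx.exists_abs_le
  obtain ⟨y, hy, m, hm⟩ := exists_perturbation hd T hC hxC hε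
  -- The shift by `1` is due to the numbering of the terms of basic sequences from `1`.
  refine hξm m (HasSchreierAbove.anti ha ((Ordinal.le_iSup ξ m).trans (le_max_right _ _)) hsup
    ⟨fun k => y (k - 1), 1, fun i hi j hj hij => ?_, by simp, fun F hF hF1 => ?_⟩)
  · have h2 := hy hij
    have h3 : 1 ≤ i := hi
    have h4 : 1 ≤ j := hj
    omega
  · have h2 : ∅ ∪ F.image (fun k => y (k - 1)) = (F.image fun k => k - 1).image y := by
      rw [empty_union, image_image]
      rfl
    rw [h2]
    refine hm _ fun c => ?_
    by_cases h0 : ∑ i ∈ F.image (fun k => k - 1), c i • x i = 0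
    · simp [h0]
    refine hcon F hF _ (Submodule.sum_mem _ fun i hi => Submodule.smul_mem _ _
      (Submodule.subset_span ⟨i, ?_, rfl⟩)) h0
    obtain ⟨k, hk, rfl⟩ := mem_image.1 hi
    change k - 1 + 1 ∈ F
    rwa [Nat.sub_add_cancel (hF1 k hk)]

end Index

/-! ### The strong operator topology -/

section StrongOperatorTopology

open Filter Topology Finset

variable {X Y : Type*} [NormedAddCommGroup X] [NormedSpace ℝ X]
  [NormedAddCommGroup Y] [NormedSpace ℝ Y]

theorem isInducing_operatorBall_coe :
    IsInducing (fun (T : OperatorBall X Y) (x : X) => T.1 x) := ⟨rfl⟩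

theorem continuous_operatorBall_apply (x : X) : Continuous fun T : OperatorBall X Y => T.1 x :=
  (continuous_apply x).comp isInducing_operatorBall_coe.continuous

theorem OperatorBall.norm_apply_le (T : OperatorBall X Y) (x : X) : ‖T.1 x‖ ≤ ‖x‖ := by
  simpa using T.1.le_of_opNorm_le T.2 x

/-- On the ball of operators pointwise convergence on a dense sequence implies pointwise
convergence. -/
theorem isInducing_operatorBall_denseRange {d : ℕ → X} (hd : DenseRange d) :
    IsInducing (fun (T : OperatorBall X Y) (n : ℕ) => T.1 (d n)) := by
  rw [isInducing_iff_nhds]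
  intro T
  refine le_antisymm ?_ ?_
  · rw [← tendsto_iff_comap]
    exact Continuous.tendsto
      (continuous_pi fun n => continuous_operatorBall_apply (Y := Y) (d n)) T
  · rw [isInducing_operatorBall_coe.nhds_eq_comap, ← tendsto_iff_comap, tendsto_pi_nhds]
    intro x
    rw [Metric.tendsto_nhds]
    intro ε hε
    obtain ⟨n, hn⟩ := hd.exists_dist_lt x (ε := ε / 3) (by positivity)
    have h1 : Tendsto (fun S : OperatorBall X Y => S.1 (d n))
        (comap (fun (T : OperatorBall X Y) (n : ℕ) => T.1 (d n)) (𝓝 fun n => T.1 (d n)))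
        (𝓝 (T.1 (d n))) :=
      tendsto_pi_nhds.1 (tendsto_comap (f := fun (T : OperatorBall X Y) (n : ℕ) => T.1 (d n))) n
    filter_upwards [Metric.tendsto_nhds.1 h1 (ε / 3) (by positivity)] with S hS
    rw [dist_eq_norm] at hn hS ⊢
    have e : S.1 x - T.1 x = S.1 (x - d n) + (S.1 (d n) - T.1 (d n)) - T.1 (x - d n) := by
      rw [map_sub, map_sub]; abel
    have h2 := S.norm_apply_le (x - d n)
    have h3 := T.norm_apply_le (x - d n)
    have h4 := norm_sub_le (S.1 (x - d n) + (S.1 (d n) - T.1 (d n))) (T.1 (x - d n))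
    have h5 := norm_add_le (S.1 (x - d n)) (S.1 (d n) - T.1 (d n))
    rw [e]
    linarith

theorem isClosedEmbedding_operatorBall [CompleteSpace X] [CompleteSpace Y] {d : ℕ → X}
    (hd : DenseRange d) :
    IsClosedEmbedding (fun (T : OperatorBall X Y) (n : ℕ) => T.1 (d n)) := by
  refine ⟨⟨isInducing_operatorBall_denseRange hd, fun S T hST => ?_⟩, ?_⟩
  · refine Subtype.ext (DFunLike.coe_injective ?_)
    exact hd.equalizer S.1.continuous T.1.continuous hST
  rw [← closure_subset_iff_isClosed]
  intro g hg
  obtain ⟨u, hu, hlim⟩ := mem_closure_iff_seq_limit.1 hg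
  choose T hT using hu
  have hTd : ∀ n, Tendsto (fun k => (T k).1 (d n)) atTop (𝓝 (g n)) := by
    intro n
    have := (tendsto_pi_nhds.1 hlim) n
    refine this.congr fun k => ?_
    rw [← hT k]
  have hex : ∀ x, ∃ y, Tendsto (fun k => (T k).1 x) atTop (𝓝 y) := by
    intro x
    refine cauchySeq_tendsto_of_complete ?_
    rw [Metric.cauchySeq_iff]
    intro ε hε
    obtain ⟨n, hn⟩ := hd.exists_dist_lt x (ε := ε / 3) (by positivity)
    obtain ⟨N, hN⟩ := Metric.cauchySeq_iff.1 (hTd n).cauchySeq (ε / 3) (by positivity)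
    refine ⟨N, fun k hk l hl => ?_⟩
    have h1 := hN k hk l hl
    rw [dist_eq_norm] at hn h1 ⊢
    have e : (T k).1 x - (T l).1 x
        = (T k).1 (x - d n) + ((T k).1 (d n) - (T l).1 (d n)) - (T l).1 (x - d n) := by
      rw [map_sub, map_sub]; abel
    have h2 := (T k).norm_apply_le (x - d n)
    have h3 := (T l).norm_apply_le (x - d n)
    have h4 := norm_sub_le ((T k).1 (x - d n) + ((T k).1 (d n) - (T l).1 (d n)))
      ((T l).1 (x - d n))
    have h5 := norm_add_le ((T k).1 (x - d n)) ((T k).1 (d n) - (T l).1 (d n))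
    rw [e]
    linarith
  choose F hF using hex
  refine ⟨⟨continuousLinearMapOfTendsto (fun k => (T k).1) (tendsto_pi_nhds.2 hF), ?_⟩, ?_⟩
  · refine ContinuousLinearMap.opNorm_le_bound _ zero_le_one fun x => ?_
    rw [one_mul]
    exact le_of_tendsto (hF x).norm (Eventually.of_forall fun k => (T k).norm_apply_le x)
  · funext n
    exact tendsto_nhds_unique (hF (d n)) (hTd n)

theorem polishSpace_operatorBall [CompleteSpace X] [TopologicalSpace.SeparableSpace X]
    [CompleteSpace Y] [TopologicalSpace.SeparableSpace Y] : PolishSpace (OperatorBall X Y) := by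
  have : SecondCountableTopology Y := UniformSpace.secondCountable_of_separable Y
  exact (isClosedEmbedding_operatorBall (Y := Y)
    (TopologicalSpace.denseRange_denseSeq X)).polishSpace

theorem isOpen_setOf_image_range_eq (n : ℕ) (t : Finset ℕ) :
    IsOpen {y : ℕ → ℕ | (range n).image y = t} := by
  rw [isOpen_iff_mem_nhds]
  intro y hy
  have h1 : ∀ᶠ y' in 𝓝 y, ∀ i ∈ range n, y' i = y i := by
    rw [Filter.eventually_all_finset]
    intro i _
    exact (continuous_apply i).continuousAt.eventually
      ((isOpen_discrete {y i}).mem_nhds rfl)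
  filter_upwards [h1] with y' hy'
  refine Eq.trans ?_ (show (range n).image y = t from hy)
  exact Finset.image_congr fun i hi => hy' i hi

/-- An operator is not strictly singular if and only if one of countably many trees, which depend
on it in a closed way, has an infinite branch. -/
theorem analyticSet_compl_strictlySingularBall [CompleteSpace X]
    [TopologicalSpace.SeparableSpace X] :
    MeasureTheory.AnalyticSet (strictlySingularBall X X)ᶜ := by
  set d := TopologicalSpace.denseSeq X
  have hd : DenseRange d := TopologicalSpace.denseRange_denseSeq X
  have : PolishSpace (OperatorBall X X) := polishSpace_operatorBall
  let C : ℕ → Set (OperatorBall X X × (ℕ → ℕ)) := fun m =>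
    {p | Function.Injective p.2 ∧ ∀ n, IsBoundedBelowOn d p.1.1 m ((range n).image p.2)}
  have hC : ∀ m, IsClosed (C m) := by
    intro m
    have h1 : IsClosed {p : OperatorBall X X × (ℕ → ℕ) | Function.Injective p.2} := by
      have e : {p : OperatorBall X X × (ℕ → ℕ) | Function.Injective p.2}
          = ⋂ (i : ℕ) (j : ℕ) (_ : i ≠ j), {p | p.2 i = p.2 j}ᶜ := by
        ext p
        simp only [Set.mem_ofPred_eq, Set.mem_iInter, Set.mem_compl_iff]
        exact ⟨fun h i j hij heq => hij (h heq),
          fun h i j heq => by_contra fun hij => h i j hij heq⟩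
      rw [e]
      refine isClosed_iInter fun i => isClosed_iInter fun j => isClosed_iInter fun _ => ?_
      rw [isClosed_compl_iff]
      have hcont : Continuous fun p : OperatorBall X X × (ℕ → ℕ) => (p.2 i, p.2 j) := by fun_prop
      exact (isOpen_discrete {q : ℕ × ℕ | q.1 = q.2}).preimage hcont
    have h2 : IsClosed {p : OperatorBall X X × (ℕ → ℕ) |
        ∀ n, IsBoundedBelowOn d p.1.1 m ((range n).image p.2)} := by
      have e : {p : OperatorBall X X × (ℕ → ℕ) |
          ∀ n, IsBoundedBelowOn d p.1.1 m ((range n).image p.2)}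
          = ⋂ (n : ℕ) (t : Finset ℕ), ({p | (range n).image p.2 = t}ᶜ ∪
              {p | IsBoundedBelowOn d p.1.1 m t}) := by
        ext p
        simp only [Set.mem_ofPred_eq, Set.mem_iInter, Set.mem_union, Set.mem_compl_iff]
        refine ⟨fun h n t => ?_, fun h n => ?_⟩
        · by_cases ht : (range n).image p.2 = t
          · exact Or.inr (ht ▸ h n)
          · exact Or.inl ht
        · exact (h n _).resolve_left fun h => h rfl
      rw [e]
      refine isClosed_iInter fun n => isClosed_iInter fun t => IsClosed.union ?_ ?_
      · rw [isClosed_compl_iff]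
        exact (isOpen_setOf_image_range_eq n t).preimage continuous_snd
      · by_cases hli : LinearIndepOn ℝ d (t : Set ℕ)
        · simp only [IsBoundedBelowOn, hli, true_and, Set.ofPred_forall]
          refine isClosed_iInter fun c => isClosed_le continuous_const ?_
          exact continuous_const.mul
            ((continuous_operatorBall_apply _).comp continuous_fst).norm
        · simp [IsBoundedBelowOn, hli]
    exact h1.inter h2
  have hunion : (strictlySingularBall X X)ᶜ = ⋃ m, Prod.fst '' C m := by
    ext T
    rw [Set.mem_compl_iff, Set.mem_iUnion]
    constructor
    · intro hT
      obtain ⟨m, y, hy, h⟩ := exists_branch_of_not_isStrictlySingular hd hT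
      exact ⟨m, (T, y), ⟨hy, h⟩, rfl⟩
    · rintro ⟨m, ⟨T, y⟩, ⟨hy, h⟩, rfl⟩
      exact not_isStrictlySingular_of_branch hy h
  rw [hunion]
  exact MeasureTheory.AnalyticSet.iUnion fun m =>
    (hC m).analyticSet.image_of_continuous continuous_fst

end StrongOperatorTopology

/-! ### Small convex combinations of pointwise null sequences -/

section ConvexCombinations

open Filter Topology Finset

/-- Mazur's theorem in `C(K)`: a bounded sequence of nonnegative continuous functions which tends
to `0` pointwise has convex combinations which are uniformly small.  A functional which separates
the sequence from the functions below `δ` is positive, hence it is given by a measure, and dominated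
convergence applies. -/
theorem exists_convex_combination_lt {K : Type*} [TopologicalSpace K] [CompactSpace K] [T2Space K]
    (f : ℕ → C(K, ℝ)) (h0 : ∀ i x, 0 ≤ f i x) (h1 : ∀ i x, f i x ≤ 1)
    (hlim : ∀ x, Tendsto (fun i => f i x) atTop (𝓝 0)) {δ : ℝ} (hδ : 0 < δ) :
    ∃ (ι : Type) (_ : Fintype ι) (w : ι → ℝ) (k : ι → ℕ), (∀ i, 0 ≤ w i) ∧ ∑ i, w i = 1 ∧
      ∀ x, ∑ i, w i * f (k i) x < δ := by
  by_contra! hcon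
  let s : Set C(K, ℝ) := {g | ∀ x, g x < δ}
  have hs : Convex ℝ s := by
    intro g hg h hh a b ha hb hab x
    have h1 := hg x
    have h2 := hh x
    simp only [ContinuousMap.add_apply, ContinuousMap.smul_apply, smul_eq_mul]
    have h3 : (a • g + b • h) x = a * g x + b * h x := rfl
    calc a * g x + b * h x < a * δ + b * δ := by
          rcases ha.eq_or_lt with rfl | ha'
          · have : b = 1 := by linarith
            subst this
            simpa using h2
          · have := mul_lt_mul_of_pos_left h1 ha'
            have := mul_le_mul_of_nonneg_left h2.le hb
            linarith
      _ = δ := by rw [← add_mul, hab, one_mul]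
  have hso : IsOpen s := by
    have e : s = {g : C(K, ℝ) | Set.MapsTo g Set.univ (Set.Iio δ)} := by
      ext g
      simp [s, Set.MapsTo]
    rw [e]
    exact ContinuousMap.isOpen_setOfPred_mapsTo isCompact_univ isOpen_Iio
  have hdisj : Disjoint s (convexHull ℝ (Set.range f)) := by
    rw [Set.disjoint_left]
    intro g hg hg'
    obtain ⟨ι, hι, w, z, hw, hw1, hz, rfl⟩ := mem_convexHull_iff_exists_fintype.1 hg'
    choose k hk using hz
    obtain ⟨x, hx⟩ := hcon ι hι w k hw hw1
    have h2 := hg x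
    simp only [ContinuousMap.coe_sum, Finset.sum_apply, ContinuousMap.coe_smul, Pi.smul_apply,
      ← hk, smul_eq_mul] at h2
    linarith
  obtain ⟨φ, u, hφs, hφt⟩ := geometric_hahn_banach_open hs hso (convex_convexHull ℝ _) hdisj
  have hu : 0 < u := by
    have := hφs 0 (fun x => by simpa using hδ)
    simpa using this
  -- The separating functional is bounded above on the cone of nonpositive functions.
  have hpos : ∀ g : C(K, ℝ), (∀ x, 0 ≤ g x) → 0 ≤ φ g := by
    intro g hg
    by_contra hneg
    rw [not_le] at hneg
    have h2 := hφs ((u / φ g) • g) (fun x => by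
      have : (u / φ g) * g x ≤ 0 :=
        mul_nonpos_of_nonpos_of_nonneg (div_nonpos_of_nonneg_of_nonpos hu.le hneg.le) (hg x)
      exact lt_of_le_of_lt this hδ)
    rw [map_smul, smul_eq_mul, div_mul_cancel₀ _ hneg.ne] at h2
    exact lt_irrefl _ h2
  let _ : MeasurableSpace K := borel K
  have : BorelSpace K := ⟨rfl⟩
  let Λ : CompactlySupportedContinuousMap K ℝ →ₚ[ℝ] ℝ :=
    PositiveLinearMap.mk₀
      { toFun := fun g => φ (g : C(K, ℝ))
        map_add' := fun g h => by rw [← map_add]; rfl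
        map_smul' := fun c g => by rw [RingHom.id_apply, ← map_smul]; rfl }
      (fun g hg => hpos _ fun x => hg x)
  let F : ℕ → CompactlySupportedContinuousMap K ℝ := fun i =>
    CompactlySupportedContinuousMap.continuousMapEquiv (f i)
  have hint : ∀ i, ∫ x, f i x ∂(RealRMK.rieszMeasure Λ) = φ (f i) := fun i =>
    RealRMK.integral_rieszMeasure Λ (F i)
  have htend : Tendsto (fun i => ∫ x, f i x ∂(RealRMK.rieszMeasure Λ)) atTop
      (𝓝 (∫ _, (0 : ℝ) ∂(RealRMK.rieszMeasure Λ))) := by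
    refine MeasureTheory.tendsto_integral_of_dominated_convergence (fun _ => 1)
      (fun i => ?_) (MeasureTheory.integrable_const _) (fun i => ?_) ?_
    · exact (f i).continuous.measurable.aestronglyMeasurable
    · exact Eventually.of_forall fun x => by
        rw [Real.norm_eq_abs, abs_of_nonneg (h0 i x)]; exact h1 i x
    · exact Eventually.of_forall hlim
  rw [MeasureTheory.integral_zero] at htend
  have hle : u ≤ 0 := by
    refine ge_of_tendsto htend (Eventually.of_forall fun i => ?_)
    rw [hint]
    exact hφt _ (subset_convexHull ℝ _ ⟨i, rfl⟩)
  linarith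

end ConvexCombinations

/-! ### Strictly singular operators on the space of absolutely summable sequences -/

section EllOne

open Filter Topology Finset

/-- The space `ℓ₁`. -/
abbrev EllOne : Type := lp (fun _ : ℕ => ℝ) 1

theorem EllOne.hasSum_abs (x : EllOne) : HasSum (fun n => |x n|) ‖x‖ := by
  simpa using lp.hasSum_norm (by simp) x

theorem EllOne.sum_abs_le (x : EllOne) (s : Finset ℕ) : ∑ n ∈ s, |x n| ≤ ‖x‖ :=
  sum_le_hasSum s (fun _ _ => abs_nonneg _) x.hasSum_abs

theorem EllOne.norm_sum_smul_single (a : ℕ → ℝ) (s : Finset ℕ) :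
    ‖∑ n ∈ s, a n • (lp.single 1 n (1 : ℝ) : EllOne)‖ = ∑ n ∈ s, |a n| := by
  have h := lp.norm_sum_single (E := fun _ : ℕ => ℝ) (p := 1) (by simp) a s
  simp only [ENNReal.toReal_one, Real.rpow_one, Real.norm_eq_abs] at h
  rw [← h]
  congr 1
  refine sum_congr rfl fun n _ => ?_
  rw [← lp.single_smul, smul_eq_mul, mul_one]

theorem EllOne.exists_schauderBasis :
    ∃ e : SchauderBasis ℝ EllOne, (∀ n, e n = lp.single (E := fun _ : ℕ => ℝ) 1 n 1) ∧
      ∀ n, ‖e n‖ = 1 := by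
  refine ⟨{ basis := fun n => lp.single (E := fun _ : ℕ => ℝ) 1 n 1
            coord := fun n => lp.evalCLM ℝ (fun _ : ℕ => ℝ) 1 n
            ortho := fun i j => ?_
            expansion := fun x => ?_ }, fun n => rfl, fun n => ?_⟩
  · change (lp.single 1 j (1 : ℝ) : EllOne) i = _
    rw [lp.single_apply]
    simp [Pi.single_apply]
  · rw [HasSum, SummationFilter.conditional_filter_eq_map_range, tendsto_map'_iff]
    have h := (lp.hasSum_single (p := 1) (by simp) x).tendsto_sum_nat
    refine h.congr fun N => ?_
    refine sum_congr rfl fun n _ => ?_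
    change lp.single (E := fun _ : ℕ => ℝ) 1 n (x n) = x n • lp.single 1 n 1
    rw [← lp.single_smul, smul_eq_mul, mul_one]
  · simp

/-- The operator `ℓ₁ → Y` which sends the unit vectors to a given bounded sequence. -/
theorem EllOne.exists_clm {Y : Type*} [NormedAddCommGroup Y] [NormedSpace ℝ Y] [CompleteSpace Y]
    (w : ℕ → Y) (hw : ∀ n, ‖w n‖ ≤ 1) :
    ∃ T : EllOne →L[ℝ] Y, ‖T‖ ≤ 1 ∧ ∀ x : EllOne, HasSum (fun n => x n • w n) (T x) := by
  have hbound : ∀ (x : EllOne) n, ‖x n • w n‖ ≤ |x n| := fun x n => by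
    rw [norm_smul, Real.norm_eq_abs]
    exact mul_le_of_le_one_right (abs_nonneg _) (hw n)
  have hsum : ∀ x : EllOne, Summable fun n => x n • w n := fun x =>
    Summable.of_norm_bounded x.hasSum_abs.summable (hbound x)
  let T : EllOne →ₗ[ℝ] Y :=
    { toFun := fun x => ∑' n, x n • w n
      map_add' := fun x y => by
        rw [← (hsum x).tsum_add (hsum y)]
        exact tsum_congr fun n => by rw [lp.coeFn_add, Pi.add_apply, add_smul]
      map_smul' := fun c x => by
        rw [RingHom.id_apply, ← (hsum x).tsum_const_smul]
        exact tsum_congr fun n => by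
          rw [lp.coeFn_smul, Pi.smul_apply, smul_eq_mul, mul_smul] }
  have hT : ∀ x, ‖T x‖ ≤ 1 * ‖x‖ := fun x => by
    rw [one_mul]
    exact tsum_of_norm_bounded x.hasSum_abs (hbound x)
  exact ⟨T.mkContinuous 1 hT, LinearMap.mkContinuous_norm_le _ zero_le_one _,
    fun x => (hsum x).hasSum⟩

/-- The gliding hump: an infinite dimensional subspace of `ℓ₁` contains a normalized sequence `z`
such that `z i` vanishes before `M j` for `j < i`, and is concentrated before `M i`. -/
theorem EllOne.exists_almost_disjoint {Z : Submodule ℝ EllOne} (hZ : ¬ FiniteDimensional ℝ Z) :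
    ∃ (z : ℕ → EllOne) (M : ℕ → ℕ), StrictMono M ∧
      (∀ i, z i ∈ Z ∧ ‖z i‖ = 1 ∧ 3 / 4 ≤ ∑ n ∈ range (M i), |z i n|) ∧
      ∀ i j, i < j → ∀ n < M i, z j n = 0 := by
  classical
  obtain ⟨p, hp, hr⟩ := exists_seq_of_forall_finset_exists
    (fun p : EllOne × ℕ => p.1 ∈ Z ∧ ‖p.1‖ = 1 ∧ 3 / 4 ≤ ∑ n ∈ range p.2, |p.1 n|)
    (fun p q => p.2 < q.2 ∧ ∀ n < p.2, q.1 n = 0) (by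
      intro s _
      set m := s.sup Prod.snd with hm
      let g : EllOne →ₗ[ℝ] (Fin m → ℝ) :=
        LinearMap.pi fun n => (lp.evalCLM ℝ (fun _ : ℕ => ℝ) 1 n : EllOne →ₗ[ℝ] ℝ)
      obtain ⟨x, hxZ, hxg, hx0⟩ := exists_mem_ker_notMem hZ g ⊥
      have hx0' : x ≠ 0 := by simpa using hx0
      have hnorm : ‖(‖x‖⁻¹ • x)‖ = 1 := by
        rw [norm_smul, norm_inv, norm_norm, inv_mul_cancel₀ (norm_ne_zero_iff.2 hx0')]
      have hvan : ∀ n < m, (‖x‖⁻¹ • x : EllOne) n = 0 := by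
        intro n hn
        have h1 : x n = 0 := congrFun hxg ⟨n, hn⟩
        rw [lp.coeFn_smul, Pi.smul_apply, h1, smul_zero]
      have htail := (‖x‖⁻¹ • x : EllOne).hasSum_abs.tendsto_sum_nat
      rw [hnorm] at htail
      obtain ⟨N, hN1, hN2⟩ := ((htail.eventually_const_lt (by norm_num : (3 / 4 : ℝ) < 1)).and
        (eventually_gt_atTop m)).exists
      refine ⟨(‖x‖⁻¹ • x, N), ⟨Z.smul_mem _ hxZ, hnorm, hN1.le⟩, fun q hq => ⟨?_, fun n hn => ?_⟩⟩
      · exact (Finset.le_sup (f := Prod.snd) hq).trans_lt hN2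
      · exact hvan n (hn.trans_le (Finset.le_sup (f := Prod.snd) hq)))
  exact ⟨fun i => (p i).1, fun i => (p i).2, fun i j hij => (hr i j hij).1, hp,
    fun i j hij => (hr i j hij).2⟩

/-- Convex combinations of an almost disjoint sequence in `ℓ₁` have norm at least `1 / 2`. -/
theorem EllOne.half_le_norm_convex_combination {z : ℕ → EllOne} {M : ℕ → ℕ}
    (hz : ∀ i, ‖z i‖ = 1 ∧ 3 / 4 ≤ ∑ n ∈ range (M i), |z i n|)
    (hM : StrictMono M) (hzM : ∀ i j, i < j → ∀ n < M i, z j n = 0)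
    {ι : Type*} [Fintype ι] {w : ι → ℝ} {k : ι → ℕ} (hw : ∀ i, 0 ≤ w i) (hw1 : ∑ i, w i = 1) :
    1 / 2 ≤ ‖∑ i, w i • z (k i)‖ := by
  classical
  have hex : ∀ n, ∃ j, n < M j := fun n => ⟨n + 1, (Nat.lt_succ_self n).trans_le hM.le_apply⟩
  -- The signs of the hump to which a coordinate belongs.
  let σ : ℕ → ℝ := fun n => SignType.sign (z (Nat.find (hex n)) n)
  have hσ : ∀ n t, σ n * t ≤ |t| ∧ -|t| ≤ σ n * t := by
    intro n t
    rcases lt_trichotomy (z (Nat.find (hex n)) n) 0 with h | h | h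
    · simp only [σ, sign_neg h, SignType.coe_neg_one, neg_one_mul]
      exact ⟨neg_le_abs t, neg_le_neg (le_abs_self t)⟩
    · simp [σ, h]
    · simp only [σ, sign_pos h, SignType.coe_one, one_mul]
      exact ⟨le_abs_self t, neg_abs_le t⟩
  have hσz : ∀ i, ∀ n < M i, σ n * z i n = |z i n| := by
    intro i n hn
    rcases (Nat.find_min' (hex n) hn).eq_or_lt with h | h
    · simp only [σ, h]
      exact sign_mul_self _
    · rw [hzM _ _ h n (Nat.find_spec (hex n))]
      simp
  obtain ⟨N, hN⟩ : ∃ N, ∀ i, M (k i) ≤ N :=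
    ⟨univ.sup fun i => M (k i), fun i => Finset.le_sup (f := fun i => M (k i)) (mem_univ i)⟩
  have hone : ∀ i, 1 / 2 ≤ ∑ n ∈ range N, σ n * z (k i) n := by
    intro i
    have h1 := (z (k i)).sum_abs_le (range N)
    rw [(hz (k i)).1, ← sum_range_add_sum_Ico _ (hN i)] at h1
    rw [← sum_range_add_sum_Ico _ (hN i)]
    have h2 : ∑ n ∈ range (M (k i)), σ n * z (k i) n = ∑ n ∈ range (M (k i)), |z (k i) n| :=
      sum_congr rfl fun n hn => hσz _ n (mem_range.1 hn)
    have h3 : -∑ n ∈ Ico (M (k i)) N, |z (k i) n| ≤ ∑ n ∈ Ico (M (k i)) N, σ n * z (k i) n := by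
      rw [← sum_neg_distrib]
      exact sum_le_sum fun n _ => (hσ n _).2
    have h4 := (hz (k i)).2
    linarith
  calc (1 / 2 : ℝ) = ∑ i, w i * (1 / 2) := by rw [← sum_mul, hw1, one_mul]
    _ ≤ ∑ i, w i * ∑ n ∈ range N, σ n * z (k i) n :=
        sum_le_sum fun i _ => mul_le_mul_of_nonneg_left (hone i) (hw i)
    _ = ∑ n ∈ range N, σ n * (∑ i, w i • z (k i) : EllOne) n := by
        simp only [mul_sum]
        rw [sum_comm]
        refine sum_congr rfl fun n _ => ?_
        rw [lp.coeFn_sum, Finset.sum_apply, mul_sum]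
        refine sum_congr rfl fun i _ => ?_
        rw [lp.coeFn_smul, Pi.smul_apply, smul_eq_mul]
        ring
    _ ≤ ∑ n ∈ range N, |(∑ i, w i • z (k i) : EllOne) n| := sum_le_sum fun n _ => (hσ n _).1
    _ ≤ ‖∑ i, w i • z (k i)‖ := EllOne.sum_abs_le _ _

/-- Let the norm of `L x` be at most the supremum of `∑_{n ∈ F} |x n|` over a compact family of
finite sets `F`.  Then `L` is strictly singular: on a sequence of almost disjoint vectors these
sums are pointwise null functions on the compact closure of the family, hence they have uniformly
small convex combinations, while the norms of the combinations stay away from `0`. -/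
theorem EllOne.isStrictlySingular_of_isCompactFamily {Y : Type*} [NormedAddCommGroup Y]
    [NormedSpace ℝ Y] {𝓕 : Set (Finset ℕ)} (h𝓕 : IsCompactFamily 𝓕) {L : EllOne →L[ℝ] Y}
    (hL : ∀ (x : EllOne) (c : ℝ), 0 ≤ c → (∀ F ∈ 𝓕, ∑ n ∈ F, |x n| ≤ c) → ‖L x‖ ≤ c) :
    IsStrictlySingular L := by
  classical
  rintro Z hZ ⟨c, hc, hcZ⟩
  obtain ⟨z, M, hM, hz, hzM⟩ := exists_almost_disjoint hZ
  -- The closure of the family, in the Cantor set.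
  let K : Set (ℕ → Bool) := {x | ∀ A : Finset ℕ, (∀ n ∈ A, x n = true) → ∃ F ∈ 𝓕, A ⊆ F}
  have hKclosed : IsClosed K := by
    have e : K = ⋂ A ∈ {A : Finset ℕ | ¬ ∃ F ∈ 𝓕, A ⊆ F}, ⋃ n ∈ A, {x | x n ≠ true} := by
      ext x
      simp only [K, Set.mem_ofPred_eq, Set.mem_iInter, Set.mem_iUnion]
      refine ⟨fun h A hA => ?_, fun h A hA => ?_⟩
      · by_contra! hcon
        exact hA (h A hcon)
      · by_contra hcon
        obtain ⟨n, hn, hxn⟩ := h A hcon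
        exact hxn (hA n hn)
    rw [e]
    refine isClosed_biInter fun A _ => isClosed_biUnion_finset fun n _ => ?_
    exact IsClosed.preimage (f := fun x : ℕ → Bool => x n) (continuous_apply n)
      (isClosed_discrete {t : Bool | t ≠ true})
  have : CompactSpace K := isCompact_iff_compactSpace.1 hKclosed.isCompact
  have hKfin : ∀ x ∈ K, {n | x n = true}.Finite := by
    intro x hx
    by_contra hinf
    obtain ⟨A, hA, hAF⟩ := h𝓕 _ hinf
    obtain ⟨F, hF, hAF'⟩ := hx A fun n hn => hA hn
    exact hAF F hF hAF'
  let b : (ℕ → Bool) → ℕ → ℝ := fun x n => if x n = true then 1 else 0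
  have hb0 : ∀ x n, 0 ≤ b x n := fun x n => by simp only [b]; split_ifs <;> norm_num
  have hb1 : ∀ x n, b x n ≤ 1 := fun x n => by simp only [b]; split_ifs <;> norm_num
  have hbc : ∀ n, Continuous fun x : K => b x n := fun n =>
    (continuous_of_discreteTopology (f := fun t : Bool => if t = true then (1 : ℝ) else 0)).comp
      ((continuous_apply n).comp continuous_subtype_val)
  have hle : ∀ i x n, |z i n| * b x n ≤ |z i n| := fun i x n =>
    mul_le_of_le_one_right (abs_nonneg _) (hb1 x n)
  have hsummable : ∀ i x, Summable fun n => |z i n| * b x n := fun i x =>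
    Summable.of_nonneg_of_le (fun n => mul_nonneg (abs_nonneg _) (hb0 x n)) (hle i x)
      (z i).hasSum_abs.summable
  let f : ℕ → C(K, ℝ) := fun i =>
    ⟨fun x => ∑' n, |z i n| * b x n, continuous_tsum (fun n => continuous_const.mul (hbc n))
      (z i).hasSum_abs.summable fun n x => by
        rw [Real.norm_eq_abs, abs_of_nonneg (mul_nonneg (abs_nonneg _) (hb0 x n))]
        exact hle i x n⟩
  have hf : ∀ i (x : K), f i x = ∑' n, |z i n| * b x n := fun i x => rfl
  obtain ⟨ι, _, w, k, hw, hw1, hsmall⟩ := exists_convex_combination_lt f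
    (fun i x => tsum_nonneg fun n => mul_nonneg (abs_nonneg _) (hb0 x n))
    (fun i x => by
      rw [hf, ← (hz i).2.1, ← (z i).hasSum_abs.tsum_eq]
      exact (hsummable i x).tsum_le_tsum (hle i x) (z i).hasSum_abs.summable)
    (fun x => by
      obtain ⟨m, hm⟩ := (hKfin x.1 x.2).bddAbove
      refine tendsto_const_nhds.congr' ?_
      filter_upwards [eventually_gt_atTop (m + 1)] with i hi
      rw [hf]
      refine ((tsum_congr fun n => ?_).trans tsum_zero).symm
      by_cases hn : x.1 n = true
      · have h1 : n < M (m + 1) := lt_of_lt_of_le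
          (Nat.lt_succ_of_le (hm hn)) hM.le_apply
        rw [hzM _ _ hi n h1, abs_zero, zero_mul]
      · simp [b, hn])
    (δ := c / 4) (by positivity)
  set v := ∑ i, w i • z (k i) with hv
  have hvZ : v ∈ Z := Submodule.sum_mem _ fun i _ => Z.smul_mem _ (hz (k i)).1
  have hvnorm : 1 / 2 ≤ ‖v‖ := half_le_norm_convex_combination (fun i => (hz i).2) hM hzM hw hw1
  have hLv : ‖L v‖ ≤ c / 4 := by
    refine hL v _ (by positivity) fun F hF => ?_
    let x : K := ⟨fun n => decide (n ∈ F), fun A hA => ⟨F, hF, fun n hn => by simpa using hA n hn⟩⟩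
    have hfx : ∀ i, f i x = ∑ n ∈ F, |z i n| := by
      intro i
      rw [hf, tsum_eq_sum (s := F) fun n hn => by simp [b, x, hn]]
      exact sum_congr rfl fun n hn => by simp [b, x, hn]
    calc ∑ n ∈ F, |v n| ≤ ∑ n ∈ F, ∑ i, w i * |z (k i) n| := by
          refine sum_le_sum fun n _ => ?_
          rw [hv, lp.coeFn_sum, Finset.sum_apply]
          refine (abs_sum_le_sum_abs _ _).trans (sum_le_sum fun i _ => ?_)
          rw [lp.coeFn_smul, Pi.smul_apply, smul_eq_mul, abs_mul, abs_of_nonneg (hw i)]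
      _ = ∑ i, w i * f (k i) x := by
          rw [sum_comm]
          exact sum_congr rfl fun i _ => by rw [hfx, mul_sum]
      _ ≤ c / 4 := (hsmall x).le
  have h1 := hcZ v hvZ
  have h2 : c * (1 / 2) ≤ c * ‖v‖ := by gcongr
  linarith

end EllOne

/-! ### Norms given by families of finite sets -/

section FamilySpace

open Filter Topology Finset

open Classical in
theorem memℓp_familyVectorFun (𝓕 : Set (Finset ℕ)) (n : ℕ) :
    Memℓp (E := fun _ : 𝓕 => EllOne)
      (fun F => if n ∈ F.1 then (lp.single 1 n (1 : ℝ) : EllOne) else 0) ⊤ := by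
  refine memℓp_infty ⟨1, ?_⟩
  rintro _ ⟨F, rfl⟩
  by_cases h : n ∈ F.1 <;> simp [h]

open Classical in
/-- The unit vectors of the space of sequences with the norm `sup_{F ∈ 𝓕} ∑_{n ∈ F} |x n|`, which is
realized by the restrictions `(x 1_F)_{F ∈ 𝓕}` in `ℓ_∞(𝓕; ℓ₁)`. -/
noncomputable def familyVector (𝓕 : Set (Finset ℕ)) (n : ℕ) : lp (fun _ : 𝓕 => EllOne) ⊤ :=
  ⟨fun F => if n ∈ F.1 then (lp.single 1 n (1 : ℝ) : EllOne) else 0, memℓp_familyVectorFun 𝓕 n⟩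

/-- The completion of the finitely supported sequences with the norm
`sup_{F ∈ 𝓕} ∑_{n ∈ F} |x n|`. -/
abbrev FamilySpace (𝓕 : Set (Finset ℕ)) : Type :=
  ↥(Submodule.span ℝ (Set.range (familyVector 𝓕))).topologicalClosure

variable {𝓕 : Set (Finset ℕ)}

theorem norm_sum_familyVector_apply (a : ℕ → ℝ) (s : Finset ℕ) (F : 𝓕) :
    ‖(∑ i ∈ s, a i • familyVector 𝓕 i : lp (fun _ : 𝓕 => EllOne) ⊤) F‖
      = ∑ i ∈ s with i ∈ F.1, |a i| := by
  classical
  rw [lp.coeFn_sum, Finset.sum_apply, ← EllOne.norm_sum_smul_single, Finset.sum_filter]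
  congr 1
  refine sum_congr rfl fun i _ => ?_
  rw [lp.coeFn_smul, Pi.smul_apply]
  change a i • (if i ∈ F.1 then (lp.single 1 i (1 : ℝ) : EllOne) else 0) = _
  rw [smul_ite, smul_zero]

theorem norm_sum_familyVector_le {a : ℕ → ℝ} {s : Finset ℕ} {c : ℝ} (hc : 0 ≤ c)
    (h : ∀ F ∈ 𝓕, ∑ i ∈ s with i ∈ F, |a i| ≤ c) : ‖∑ i ∈ s, a i • familyVector 𝓕 i‖ ≤ c :=
  lp.norm_le_of_forall_le hc fun F => by
    rw [norm_sum_familyVector_apply]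
    exact h F.1 F.2

theorem sum_abs_le_norm_sum_familyVector (a : ℕ → ℝ) (s : Finset ℕ) {F : Finset ℕ} (hF : F ∈ 𝓕) :
    ∑ i ∈ s with i ∈ F, |a i| ≤ ‖∑ i ∈ s, a i • familyVector 𝓕 i‖ := by
  rw [← norm_sum_familyVector_apply a s ⟨F, hF⟩]
  exact lp.norm_apply_le_norm ENNReal.top_ne_zero _ _

theorem norm_familyVector {n : ℕ} (hn : {n} ∈ 𝓕) : ‖familyVector 𝓕 n‖ = 1 := by
  classical
  have h1 := norm_sum_familyVector_le (𝓕 := 𝓕) (a := fun _ => 1) (s := {n}) zero_le_one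
    (fun F _ => by rw [Finset.filter_singleton]; split_ifs <;> simp)
  have h2 := sum_abs_le_norm_sum_familyVector (𝓕 := 𝓕) (fun _ => 1) {n} hn
  simp only [sum_singleton, one_smul] at h1 h2
  rw [Finset.filter_true_of_mem fun _ h => h, sum_singleton, abs_one] at h2
  exact le_antisymm h1 h2

/-- The unit vectors are a monotone basis, as the norm is monotone in the absolute values of the
coordinates. -/
theorem exists_schauderBasis_familySpace (h : ∀ n, {n} ∈ 𝓕) :
    ∃ b : SchauderBasis ℝ (FamilySpace 𝓕), ∀ n, ((b n : FamilySpace 𝓕) :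
      lp (fun _ : 𝓕 => EllOne) ⊤) = familyVector 𝓕 n := by
  refine isBasicSequence_of_norm_sum_le (K := 1) (fun n hn => ?_) fun a m n hmn => ?_
  · simpa [hn] using norm_familyVector (h n)
  · rw [one_mul]
    refine norm_sum_familyVector_le (norm_nonneg _) fun F hF =>
      (sum_le_sum_of_subset_of_nonneg ?_ fun _ _ _ => abs_nonneg _).trans
        (sum_abs_le_norm_sum_familyVector a (range n) hF)
    exact filter_subset_filter _ (range_subset_range.2 hmn)

end FamilySpace

/-! ### Multipliers on universal spaces -/

section Operators

open Filter Topology Finset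

/-- The ideal property of the strictly singular operators. -/
theorem IsStrictlySingular.comp_comp {V W X Y : Type*} [NormedAddCommGroup V] [NormedSpace ℝ V]
    [NormedAddCommGroup W] [NormedSpace ℝ W] [NormedAddCommGroup X] [NormedSpace ℝ X]
    [NormedAddCommGroup Y] [NormedSpace ℝ Y] {S : V →L[ℝ] W} (hS : IsStrictlySingular S)
    (J : W →L[ℝ] Y) (Q : X →L[ℝ] V) : IsStrictlySingular (J.comp (S.comp Q)) := by
  rintro Z hZ ⟨c, hc, hcZ⟩
  have h1 : ∀ z ∈ Z, c * ‖z‖ ≤ ‖J‖ * ‖S (Q z)‖ := fun z hz =>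
    (hcZ z hz).trans (J.le_opNorm (S (Q z)))
  refine hS (Z.map (Q : X →ₗ[ℝ] V)) (fun hfd => hZ ?_)
    ⟨c / ((‖J‖ + 1) * (‖Q‖ + 1)), by positivity, ?_⟩
  · refine (Submodule.fg_iff_finiteDimensional Z).1 (Submodule.fg_of_fg_map_of_fg_inf_ker
      (Q : X →ₗ[ℝ] V) ((Submodule.fg_iff_finiteDimensional _).2 hfd) ?_)
    have hbot : Z ⊓ LinearMap.ker (Q : X →ₗ[ℝ] V) = ⊥ := by
      refine (Submodule.eq_bot_iff _).2 fun z hz => ?_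
      have h2 := h1 z hz.1
      have h3 : Q z = 0 := hz.2
      rw [h3, map_zero, norm_zero, mul_zero] at h2
      have := norm_nonneg z
      exact norm_le_zero_iff.1 (by nlinarith)
    rw [hbot]
    exact Submodule.fg_bot
  · rintro _ ⟨z, hz, rfl⟩
    change c / ((‖J‖ + 1) * (‖Q‖ + 1)) * ‖Q z‖ ≤ ‖S (Q z)‖
    rw [div_mul_eq_mul_div, div_le_iff₀ (by positivity)]
    calc c * ‖Q z‖ ≤ c * (‖Q‖ * ‖z‖) := by gcongr; exact Q.le_opNorm z
      _ = ‖Q‖ * (c * ‖z‖) := by ring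
      _ ≤ ‖Q‖ * (‖J‖ * ‖S (Q z)‖) := mul_le_mul_of_nonneg_left (h1 z hz) (norm_nonneg _)
      _ ≤ (‖Q‖ + 1) * ((‖J‖ + 1) * ‖S (Q z)‖) := by gcongr <;> linarith
      _ = ‖S (Q z)‖ * ((‖J‖ + 1) * (‖Q‖ + 1)) := by ring

/-- The operators on a universal space which are used for both lower bounds: up to the embeddings
into `U` and the projections onto the images, they are the maps `x ↦ 1_χ x` from `ℓ₁` to the space
with the norm `sup_{F ∈ 𝓕} ∑_{n ∈ F} |x n|`. -/
theorem IsPelczynskiUniversal.exists_multipliers {U : Type*} [NormedAddCommGroup U]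
    [NormedSpace ℝ U] [CompleteSpace U] (hU : IsPelczynskiUniversal U) {𝓕 : Set (Finset ℕ)}
    (h𝓕 : ∀ n, {n} ∈ 𝓕) :
    ∃ (Θ : (ℕ → Bool) → OperatorBall U U) (u : SchauderBasis ℝ U) (φ : ℕ → ℕ) (c : ℝ),
      Continuous Θ ∧ StrictMono φ ∧ (∀ n, ‖u n‖ = 1) ∧ 0 < c ∧
      (∀ χ, IsCompactFamily {G | ∃ F ∈ 𝓕, G = {n ∈ F | χ n = true}} →
        IsStrictlySingular (Θ χ).1) ∧
      ∀ χ, ∀ F ∈ 𝓕, (∀ n ∈ F, χ n = true) → ∀ a : ℕ → ℝ,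
        c * ‖∑ n ∈ F, a n • u (φ n)‖ ≤ ‖(Θ χ).1 (∑ n ∈ F, a n • u (φ n))‖ := by
  classical
  obtain ⟨u, hu, huniv⟩ := hU
  obtain ⟨e, he, he1⟩ := EllOne.exists_schauderBasis
  obtain ⟨φ, hφ, JV, QV, hJV, hQV⟩ := huniv EllOne e he1
  obtain ⟨b, hb⟩ := exists_schauderBasis_familySpace h𝓕
  have hb1 : ∀ n, ‖b n‖ = 1 := fun n => by
    rw [Submodule.coe_norm, hb, norm_familyVector (h𝓕 n)]
  obtain ⟨ψ, -, JW, QW, -, hQW⟩ := huniv (FamilySpace 𝓕) b hb1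
  let w : (ℕ → Bool) → ℕ → FamilySpace 𝓕 := fun χ n => if χ n = true then b n else 0
  have hw : ∀ χ n, ‖w χ n‖ ≤ 1 := by
    intro χ n
    simp only [w]
    split_ifs
    · exact (hb1 n).le
    · simp
  choose S hS1 hS using fun χ => EllOne.exists_clm (w χ) (hw χ)
  have hSe : ∀ χ n, S χ (e n) = w χ n := by
    intro χ n
    refine (hS χ (e n)).unique ?_
    have h1 : ∀ m, (e n : EllOne) m = if m = n then 1 else 0 := by
      intro m
      rw [he, lp.single_apply]
      simp [Pi.single_apply]
    have h2 := hasSum_single (f := fun m => (e n : EllOne) m • w χ m) n fun m hm => by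
      rw [h1, if_neg hm, zero_smul]
    simpa [h1] using h2
  have hsumb : ∀ (a : ℕ → ℝ) (s : Finset ℕ), ‖∑ i ∈ s, a i • b i‖
      = ‖∑ i ∈ s, a i • familyVector 𝓕 i‖ := by
    intro a s
    rw [Submodule.coe_norm]
    simp [hb]
  -- A normalization, which brings the operators into the unit ball.
  set κ : ℝ := (‖JW‖ * ‖QV‖ + 1)⁻¹ with hκ
  have hκ0 : 0 < κ := by positivity
  have hκJ : ‖κ • JW‖ ≤ κ * ‖JW‖ := by
    refine ContinuousLinearMap.opNorm_le_bound _ (by positivity) fun x => ?_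
    rw [_root_.smul_apply, norm_smul, Real.norm_of_nonneg hκ0.le, mul_assoc]
    exact mul_le_mul_of_nonneg_left (JW.le_opNorm x) hκ0.le
  have hball : ∀ χ, ‖(κ • JW).comp ((S χ).comp QV)‖ ≤ 1 := by
    intro χ
    calc ‖(κ • JW).comp ((S χ).comp QV)‖ ≤ ‖κ • JW‖ * (‖S χ‖ * ‖QV‖) :=
          (ContinuousLinearMap.opNorm_comp_le _ _).trans
            (by gcongr; exact ContinuousLinearMap.opNorm_comp_le _ _)
      _ ≤ (κ * ‖JW‖) * (1 * ‖QV‖) := by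
          gcongr
          exact hS1 χ
      _ = κ * (‖JW‖ * ‖QV‖) := by ring
      _ ≤ κ * (‖JW‖ * ‖QV‖ + 1) := by gcongr; linarith
      _ = 1 := inv_mul_cancel₀ (by positivity)
  refine ⟨fun χ => ⟨(κ • JW).comp ((S χ).comp QV), hball χ⟩, u, φ, κ / (‖QW‖ + 1), ?_, hφ, hu,
    by positivity, fun χ hχ => ?_, fun χ F hF hFχ a => ?_⟩
  · refine isInducing_operatorBall_coe.continuous_iff.2 (continuous_pi fun x => ?_)
    have h1 : Continuous fun χ => S χ (QV x) := by
      have h2 : ∀ χ, S χ (QV x) = ∑' n, QV x n • w χ n := fun χ => (hS χ (QV x)).tsum_eq.symm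
      simp only [h2]
      refine continuous_tsum (u := fun n => |QV x n|) (fun n => ?_)
        (QV x).hasSum_abs.summable fun n χ => ?_
      · have h3 : Continuous fun χ => w χ n :=
          Continuous.comp (g := fun t : Bool => if t = true then b n else 0)
            (f := fun χ : ℕ → Bool => χ n) continuous_of_discreteTopology (continuous_apply n)
        exact Continuous.const_smul (M := ℝ) h3 (QV x n)
      · rw [norm_smul, Real.norm_eq_abs]
        exact mul_le_of_le_one_right (abs_nonneg _) (hw χ n)
    exact (κ • JW).continuous.comp h1
  · refine (EllOne.isStrictlySingular_of_isCompactFamily hχ fun x c hc hx => ?_).comp_comp _ _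
    refine le_of_tendsto (hS χ x).tendsto_sum_nat.norm (Eventually.of_forall fun N => ?_)
    have h1 : ∑ i ∈ range N, x i • w χ i
        = ∑ i ∈ range N, (if χ i = true then x i else 0) • b i := by
      refine sum_congr rfl fun i _ => ?_
      simp only [w]
      split_ifs <;> simp
    rw [h1, hsumb]
    refine norm_sum_familyVector_le hc fun F hF => le_trans ?_ (hx _ ⟨F, hF, rfl⟩)
    calc ∑ i ∈ range N with i ∈ F, |if χ i = true then x i else 0|
        ≤ ∑ i ∈ F, |if χ i = true then x i else 0| :=
          sum_le_sum_of_subset_of_nonneg (fun i hi => (mem_filter.1 hi).2)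
            fun _ _ _ => abs_nonneg _
      _ = ∑ i ∈ F with χ i = true, |x i| := by
          rw [Finset.sum_filter]
          refine sum_congr rfl fun i _ => ?_
          split_ifs <;> simp
  · have h1 : QV (∑ n ∈ F, a n • u (φ n)) = ∑ n ∈ F, a n • e n := by
      simp only [map_sum, map_smul, ← hJV, hQV]
    have h2 : S χ (∑ n ∈ F, a n • e n) = ∑ n ∈ F, a n • b n := by
      simp only [map_sum, map_smul, hSe]
      exact sum_congr rfl fun n hn => by simp only [w]; rw [if_pos (hFχ n hn)]
    have h3 : ‖∑ n ∈ F, a n • u (φ n)‖ ≤ ‖∑ n ∈ F, a n • b n‖ := by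
      have h4 := sum_abs_le_norm_sum_familyVector a F hF
      rw [Finset.filter_true_of_mem fun _ h => h] at h4
      rw [hsumb]
      refine le_trans ?_ h4
      refine (norm_sum_le _ _).trans (sum_le_sum fun n _ => ?_)
      rw [norm_smul, hu, mul_one, Real.norm_eq_abs]
    have h4 : ‖∑ n ∈ F, a n • b n‖ ≤ (‖QW‖ + 1) * ‖JW (∑ n ∈ F, a n • b n)‖ := by
      have h5 := QW.le_opNorm (JW (∑ n ∈ F, a n • b n))
      rw [hQW] at h5
      refine h5.trans ?_
      gcongr
      linarith
    change _ ≤ ‖κ • JW (S χ (QV (∑ n ∈ F, a n • u (φ n))))‖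
    rw [h1, h2, norm_smul, Real.norm_of_nonneg hκ0.le, div_mul_eq_mul_div,
      div_le_iff₀ (by positivity), mul_assoc]
    refine mul_le_mul_of_nonneg_left ?_ hκ0.le
    linarith

end Operators

/-! ### The strictly singular operators do not form a Borel set -/

section NotBorel

open Filter Topology Finset

/-- The code of the pair of initial segments of length `n` of a point of the Cantor space and of a
point of the Baire space. -/
def segmentCode (z : ℕ → Bool) (y : ℕ → ℕ) (n : ℕ) : ℕ :=
  Encodable.encode ((List.range n).map z, (List.range n).map y)

theorem segmentCode_eq_iff {z z' : ℕ → Bool} {y y' : ℕ → ℕ} {n n' : ℕ} :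
    segmentCode z y n = segmentCode z' y' n' ↔
      n = n' ∧ ∀ i < n, z i = z' i ∧ y i = y' i := by
  rw [segmentCode, segmentCode, Encodable.encode_inj, Prod.mk.injEq]
  constructor
  · rintro ⟨h1, h2⟩
    have hn : n = n' := by simpa using congrArg List.length h1
    subst hn
    rw [List.map_inj_left] at h1 h2
    exact ⟨rfl, fun i hi => ⟨h1 i (List.mem_range.2 hi), h2 i (List.mem_range.2 hi)⟩⟩
  · rintro ⟨rfl, h⟩
    rw [List.map_inj_left, List.map_inj_left]
    exact ⟨fun i hi => (h i (List.mem_range.1 hi)).1, fun i hi => (h i (List.mem_range.1 hi)).2⟩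

/-- The diagonal argument for the existence of coanalytic sets which are not Borel: every
`w : ℕ → Bool` codes the analytic set of all `x` such that for some `y` all codes of initial segments of
`(x, y)` are in `w`, and all analytic sets are of this form.  The set of all `z` which are not in
the set coded by `z` is not analytic. -/
theorem not_measurableSet_diagonal :
    ¬ MeasurableSet {z : ℕ → Bool | ¬ ∃ y : ℕ → ℕ, ∀ n, z (segmentCode z y n) = true} := by
  classical
  intro hmeas
  have : SecondCountableTopology (ℕ → Bool) := inferInstance
  have : TopologicalSpace.IsCompletelyMetrizableSpace (ℕ → Bool) := inferInstance
  have hana := hmeas.analyticSet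
  rw [MeasureTheory.AnalyticSet] at hana
  rcases hana with hempty | ⟨f, hf, hrange⟩
  · have h1 : (fun _ => false : ℕ → Bool) ∈
        {z : ℕ → Bool | ¬ ∃ y : ℕ → ℕ, ∀ n, z (segmentCode z y n) = true} := by
      simp
    rw [hempty] at h1
    exact h1
  -- The set coded by `w` is the range of `f`: its members are the codes of the initial segments of
  -- the points `(f y, y)`.
  set w : ℕ → Bool := fun c => decide (∃ (y : ℕ → ℕ) (n : ℕ), c = segmentCode (f y) y n) with hw
  have hmem : w ∈ Set.range f ↔ ¬ ∃ y : ℕ → ℕ, ∀ n, w (segmentCode w y n) = true := by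
    rw [hrange]; rfl
  by_cases hwf : w ∈ Set.range f
  · obtain ⟨y, hy⟩ := hwf
    refine hmem.1 ⟨y, hy⟩ ⟨y, fun n => ?_⟩
    rw [← hy] at hw ⊢
    rw [hw]
    exact decide_eq_true ⟨y, n, by rw [← hw]⟩
  · obtain ⟨y, hy⟩ := not_not.1 fun h => hwf (hmem.2 h)
    have h1 : ∀ n, ∃ y' : ℕ → ℕ, ∀ i < n, w i = f y' i ∧ y i = y' i := by
      intro n
      obtain ⟨y', n', h⟩ := of_decide_eq_true (hy n)
      exact ⟨y', (segmentCode_eq_iff.1 h).2⟩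
    choose y' hy' using h1
    have hlim : Tendsto y' atTop (𝓝 y) := by
      refine tendsto_pi_nhds.2 fun i => tendsto_const_nhds.congr' ?_
      filter_upwards [eventually_gt_atTop i] with n hn using (hy' n i hn).2
    have hlim1 := (hf.tendsto y).comp hlim
    have hlim2 : Tendsto (f ∘ y') atTop (𝓝 w) := by
      refine tendsto_pi_nhds.2 fun i => tendsto_const_nhds.congr' ?_
      filter_upwards [eventually_gt_atTop i] with n hn using (hy' n i hn).1
    exact hwf ⟨y, tendsto_nhds_unique hlim1 hlim2⟩

open Classical in
/-- The tree of the nodes `s` such that, for all initial segments of `s`, the code of the pair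
formed with the initial segment of `z` of the same length is in `z`; nodes are numbered by an
enumeration of the lists. -/
noncomputable def diagonalTree (z : ℕ → Bool) (c : ℕ) : Bool :=
  decide (∀ k ∈ range ((Denumerable.ofNat (List ℕ) c).length + 1),
    z (Encodable.encode ((List.range k).map z, (Denumerable.ofNat (List ℕ) c).take k)) = true)

theorem diagonalTree_eq_true_iff {z : ℕ → Bool} {c : ℕ} : diagonalTree z c = true ↔
    ∀ k ∈ range ((Denumerable.ofNat (List ℕ) c).length + 1),
      z (Encodable.encode ((List.range k).map z, (Denumerable.ofNat (List ℕ) c).take k))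
        = true := by
  simp only [diagonalTree, decide_eq_true_iff]

theorem continuous_diagonalTree : Continuous diagonalTree := by
  refine continuous_pi fun c => continuous_iff_continuousAt.2 fun z => ?_
  let s := Denumerable.ofNat (List ℕ) c
  let S : Finset ℕ := range (s.length + 1) ∪ (range (s.length + 1)).image fun k =>
    Encodable.encode ((List.range k).map z, s.take k)
  have h1 : ∀ᶠ z' in 𝓝 z, ∀ i ∈ S, z' i = z i := by
    rw [Filter.eventually_all_finset]
    intro i _
    exact (continuous_apply i).continuousAt.eventually ((isOpen_discrete {z i}).mem_nhds rfl)
  have h2 : (fun _ : ℕ → Bool => diagonalTree z c) =ᶠ[𝓝 z] fun z' => diagonalTree z' c := by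
    filter_upwards [h1] with z' hz'
    rw [Bool.eq_iff_iff, diagonalTree_eq_true_iff, diagonalTree_eq_true_iff]
    refine forall₂_congr fun k hk => ?_
    have h3 : (List.range k).map z' = (List.range k).map z := by
      rw [List.map_inj_left]
      intro i hi
      have h4 := List.mem_range.1 hi
      have h5 : k < s.length + 1 := mem_range.1 hk
      exact hz' i (mem_union_left _ (mem_range.2 (by omega)))
    rw [h3, hz' _ (mem_union_right _ (mem_image_of_mem _ hk))]
  exact continuousAt_const.congr h2

/-- The finite sets of nodes which lie on a common branch. -/
def branchFamily : Set (Finset ℕ) :=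
  {F | ∃ y : ℕ → ℕ, ∀ c ∈ F, ∃ n, Denumerable.ofNat (List ℕ) c = (List.range n).map y}

theorem singleton_mem_branchFamily (c : ℕ) : {c} ∈ branchFamily := by
  refine ⟨fun i => (Denumerable.ofNat (List ℕ) c).getD i 0, fun c' hc' => ?_⟩
  rw [mem_singleton.1 hc']
  refine ⟨(Denumerable.ofNat (List ℕ) c).length, List.ext_getElem (by simp) fun i hi _ => ?_⟩
  simp [hi]

/-- If the tree of `z` has no infinite branch, then the finite parts of its branches form a compact
family. -/
theorem isCompactFamily_diagonalTree {z : ℕ → Bool}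
    (hz : ¬ ∃ y : ℕ → ℕ, ∀ n, z (segmentCode z y n) = true) :
    IsCompactFamily {G | ∃ F ∈ branchFamily, G = {n ∈ F | diagonalTree z n = true}} := by
  classical
  intro M hM
  by_contra! hcon
  have hpair : ∀ A : Finset ℕ, ↑A ⊆ M → (∀ c ∈ A, diagonalTree z c = true) ∧
      ∃ y : ℕ → ℕ, ∀ c ∈ A, ∃ n, Denumerable.ofNat (List ℕ) c = (List.range n).map y := by
    intro A hA
    obtain ⟨_, ⟨F, ⟨y, hy⟩, rfl⟩, hAF⟩ := hcon A hA
    exact ⟨fun c hc => (mem_filter.1 (hAF hc)).2, y, fun c hc => hy c (mem_filter.1 (hAF hc)).1⟩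
  -- The lengths of the nodes of an infinite chain are unbounded.
  have hlong : ∀ n, ∃ c ∈ M, n < (Denumerable.ofNat (List ℕ) c).length := by
    intro n
    by_contra! hshort
    refine Set.infinite_of_injOn_mapsTo (f := fun c => (Denumerable.ofNat (List ℕ) c).length)
      (t := Set.Iic n) ?_ (fun c hc => hshort c hc) hM (Set.finite_Iic n)
    intro c hc c' hc' hlen
    obtain ⟨-, y, hy⟩ := hpair {c, c'} (by
      intro x hx
      rcases mem_insert.1 (mem_coe.1 hx) with rfl | hx
      · exact hc
      · rwa [mem_singleton.1 hx])
    obtain ⟨k, hk⟩ := hy c (by simp)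
    obtain ⟨k', hk'⟩ := hy c' (by simp)
    have hkk : k = k' := by simpa [hk, hk'] using hlen
    have h3 : Denumerable.ofNat (List ℕ) c = Denumerable.ofNat (List ℕ) c' := by rw [hk, hk', hkk]
    have h4 := congrArg (Encodable.encode (α := List ℕ)) h3
    simpa using h4
  choose C hCM hC using hlong
  refine hz ⟨fun k => (Denumerable.ofNat (List ℕ) (C k)).getD k 0, fun n => ?_⟩
  obtain ⟨htree, -⟩ := hpair {C n} (by simpa using hCM n)
  have h1 := diagonalTree_eq_true_iff.1 (htree (C n) (mem_singleton_self _)) n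
    (mem_range.2 ((hC n).trans (Nat.lt_succ_self _)))
  have h2 : (Denumerable.ofNat (List ℕ) (C n)).take n
      = (List.range n).map fun k => (Denumerable.ofNat (List ℕ) (C k)).getD k 0 := by
    refine List.ext_getElem (by simpa using (hC n).le) fun k hk _ => ?_
    have hkn : k < n := by
      simp only [List.length_take] at hk
      omega
    obtain ⟨-, y, hy⟩ := hpair {C n, C k} (by
      intro x hx
      rcases mem_insert.1 (mem_coe.1 hx) with rfl | hx
      · exact hCM n
      · rw [mem_singleton.1 hx]; exact hCM k)
    obtain ⟨m, hm⟩ := hy (C n) (by simp)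
    obtain ⟨m', hm'⟩ := hy (C k) (by simp)
    have hlen := hC k
    rw [hm', List.length_map, List.length_range] at hlen
    rw [List.getElem_take, List.getElem_map, List.getElem_range]
    simp [hm, hm', hlen]
  rw [h2] at h1
  exact h1

variable {U : Type*} [NormedAddCommGroup U] [NormedSpace ℝ U] [CompleteSpace U]

/-- The multiplier by the tree of `z` is a continuous function of `z`, and it is strictly singular
if and only if the tree has no infinite branch.  So a set which is not Borel is the preimage of the
set of strictly singular operators. -/
theorem IsPelczynskiUniversal.not_measurableSet_strictlySingularBall
    (hU : IsPelczynskiUniversal U) :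
    ¬ @MeasurableSet (OperatorBall U U) (borel (OperatorBall U U)) (strictlySingularBall U U) := by
  classical
  intro hmeas
  obtain ⟨Θ, u, φ, c, hΘ, hφ, -, hc, hss, hlow⟩ :=
    hU.exists_multipliers singleton_mem_branchFamily
  let _ : MeasurableSpace (OperatorBall U U) := borel _
  have : BorelSpace (OperatorBall U U) := ⟨rfl⟩
  have hpre : MeasurableSet ((fun z => Θ (diagonalTree z)) ⁻¹' strictlySingularBall U U) :=
    (hΘ.comp continuous_diagonalTree).measurable hmeas
  refine not_measurableSet_diagonal ?_
  convert hpre using 1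
  ext z
  refine ⟨fun hz => hss _ (isCompactFamily_diagonalTree hz), fun hz => ?_⟩
  rintro ⟨y, hy⟩
  -- Along a branch of the tree the operator is bounded below.
  let m : ℕ → ℕ := fun n => Encodable.encode ((List.range n).map y)
  have hm : ∀ n, Denumerable.ofNat (List ℕ) (m n) = (List.range n).map y := fun n => by simp [m]
  have hminj : Function.Injective m := by
    intro n n' h
    have h1 := congrArg List.length (Encodable.encode_injective h)
    simpa using h1
  have htree : ∀ n, diagonalTree z (m n) = true := by
    intro n
    refine diagonalTree_eq_true_iff.2 fun k hk => ?_
    rw [hm] at hk ⊢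
    rw [List.length_map, List.length_range, mem_range] at hk
    have h1 : ((List.range n).map y).take k = (List.range k).map y := by
      rw [← List.map_take, List.take_range, min_eq_left (by omega)]
    rw [h1]
    exact hy k
  have hli : LinearIndependent ℝ fun n => u (φ (m n)) :=
    u.linearIndependent.comp _ (hφ.injective.comp hminj)
  refine hz (Submodule.span ℝ (Set.range fun n => u (φ (m n)))) (fun hfd => ?_)
    ⟨c, hc, fun v hv => ?_⟩
  · have := (linearIndependent_span hli).finite_of_isNoetherian
    exact not_finite ℕ
  · obtain ⟨a, N, -, rfl⟩ := exists_sum_range_eq_of_mem_span hv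
    have h1 := hlow (diagonalTree z) ((range N).image m)
      ⟨y, fun c' hc' => by
        obtain ⟨n, -, rfl⟩ := mem_image.1 hc'
        exact ⟨n, hm n⟩⟩
      (fun c' hc' => by
        obtain ⟨n, -, rfl⟩ := mem_image.1 hc'
        exact htree n) (fun j => a (Function.invFun m j))
    rw [sum_image hminj.injOn] at h1
    simpa only [Function.leftInverse_invFun hminj _] using h1

end NotBorel

/-! ### The Schreier index is uncountable -/

section Columns

open Filter Topology Finset

variable {a : Ordinal.{0} → ℕ → Ordinal.{0}}

/-- Copies of countably many families of finite sets on the columns of `ℕ × ℕ`, together with the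
singletons. -/
def columnFamily (S : ℕ → Set (Finset ℕ)) : Set (Finset ℕ) :=
  {F | (∃ n, F = {n}) ∨ ∃ k, ∃ G ∈ S k, F = G.image (Nat.pair k)}

/-- A member with two elements lies in one column.  Hence an infinite set all of whose finite
subsets lie in members of the family is contained in one column, where it contradicts compactness.
-/
theorem IsCompactFamily.columnFamily {S : ℕ → Set (Finset ℕ)} (hS : ∀ k, IsCompactFamily (S k)) :
    IsCompactFamily (columnFamily S) := by
  classical
  intro M hM
  by_contra! hcon
  obtain ⟨m, hm⟩ := hM.nonempty
  -- A member of the family with two elements lies in one column.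
  have hcol : ∀ A : Finset ℕ, ↑A ⊆ M → ∀ m' ∈ M, m' ≠ m →
      ∃ G ∈ S m.unpair.1, insert m (insert m' A) ⊆ G.image (Nat.pair m.unpair.1) := by
    intro A hA m' hm' hne
    obtain ⟨F, hF, hAF⟩ := hcon (insert m (insert m' A)) (by
      rw [coe_insert, coe_insert]
      exact Set.insert_subset hm (Set.insert_subset hm' hA))
    have hmF : m ∈ F := hAF (mem_insert_self _ _)
    rcases hF with ⟨n, rfl⟩ | ⟨k, G, hG, rfl⟩
    · have h1 := mem_singleton.1 hmF
      have h2 := mem_singleton.1 (hAF (mem_insert_of_mem (mem_insert_self m' A)))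
      exact absurd (h2.trans h1.symm) hne
    · obtain ⟨j, -, hj⟩ := mem_image.1 hmF
      have hk : m.unpair.1 = k := by rw [← hj, Nat.unpair_pair]
      rw [hk]
      exact ⟨G, hG, hAF⟩
  have hpair_inj : Function.Injective (Nat.pair m.unpair.1) := fun i j h => by
    simpa using h
  have hM' : {j | Nat.pair m.unpair.1 j ∈ M}.Infinite := by
    have hsub : M \ {m} ⊆ Nat.pair m.unpair.1 '' {j | Nat.pair m.unpair.1 j ∈ M} := by
      rintro m' ⟨hm', hne⟩
      obtain ⟨G, -, hG⟩ := hcol ∅ (by simp) m' hm' hne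
      obtain ⟨j, -, rfl⟩ := mem_image.1 (hG (mem_insert_of_mem (mem_insert_self m' ∅)))
      exact ⟨j, hm', rfl⟩
    exact ((hM.sdiff (Set.finite_singleton m)).mono hsub).of_image _
  obtain ⟨m', hm', hne⟩ := (hM.sdiff (Set.finite_singleton m)).nonempty
  obtain ⟨A, hA, hAG⟩ := hS _ _ hM'
  obtain ⟨G, hG, hsub⟩ := hcol (A.image (Nat.pair m.unpair.1)) (by
    intro x hx
    obtain ⟨j, hj, rfl⟩ := mem_image.1 (mem_coe.1 hx)
    exact hA hj) m' hm' hne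
  refine hAG G hG fun j hj => ?_
  obtain ⟨j', hj', h⟩ := mem_image.1 (hsub (mem_insert_of_mem (mem_insert_of_mem
    (mem_image_of_mem _ hj))))
  rwa [← hpair_inj h]

variable {U : Type*} [NormedAddCommGroup U] [NormedSpace ℝ U] [CompleteSpace U]

/-- For `ξ < ω₁` there are only countably many `ζ ≤ ξ`.  The family of copies of `S_ζ` in different
columns, one for each `ζ`, is compact, so its multiplier is strictly singular, but it is bounded
below on the spans of the members of each `S_ζ`. -/
theorem IsPelczynskiUniversal.exists_not_isSchreierStrictlySingular
    (hU : IsPelczynskiUniversal U) (ha : IsSchreierChoice a) {ξ : Ordinal.{0}} (hξ : ξ < ω₁) :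
    ∃ T : U →L[ℝ] U, IsStrictlySingular T ∧ ∀ ζ ≤ ξ, ¬ IsSchreierStrictlySingular a ζ T := by
  classical
  obtain ⟨g, hg⟩ := (countable_Iic_of_lt_omega_one hξ).exists_eq_range Set.nonempty_Iic
  have hgξ : ∀ k, g k < ω₁ := fun k =>
    lt_of_le_of_lt (show g k ∈ Set.Iic ξ by rw [hg]; exact ⟨k, rfl⟩) hξ
  obtain ⟨Θ, u, φ, c, -, hφ, hu, hc, hss, hlow⟩ := hU.exists_multipliers
    (𝓕 := columnFamily fun k => schreier a (g k)) fun n => Or.inl ⟨n, rfl⟩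
  refine ⟨(Θ fun _ => true).1, hss _ ?_, fun ζ hζ hT => ?_⟩
  · have h1 := IsCompactFamily.columnFamily fun k => isCompactFamily_schreier ha (hgξ k)
    simpa using h1
  · obtain ⟨k, rfl⟩ : ∃ k, g k = ζ := by
      have : ζ ∈ Set.Iic ξ := hζ
      rwa [hg] at this
    have hmono : StrictMono fun j => φ (Nat.pair k (j + 1)) := fun i j hij =>
      hφ (Nat.pair_lt_pair_right _ (by omega))
    -- The shift by `1` is due to the numbering of the terms of basic sequences from `1`.
    obtain ⟨F, hF, v, hv, hv0, hTv⟩ := hT c hc (fun j => u (φ (Nat.pair k (j + 1))))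
      (u.isBasicSequence_comp hmono) (fun n => hu _)
    have hv' : v ∈ Submodule.span ℝ ((fun n => u (φ n)) '' ↑(F.image (Nat.pair k))) := by
      refine Submodule.span_mono ?_ hv
      rintro _ ⟨j, hj, rfl⟩
      exact ⟨Nat.pair k (j + 1), mem_coe.2 (mem_image_of_mem _ hj), rfl⟩
    obtain ⟨b, rfl⟩ := (Submodule.mem_span_image_finset_iff_exists_fun' ℝ).1 hv'
    have h1 := hlow (fun _ => true) (F.image (Nat.pair k)) (Or.inr ⟨k, F, hF, rfl⟩)
      (fun _ _ => rfl) b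
    exact absurd hTv (not_lt.2 h1)

/-- By the hypothesis `h` the infima are attained, and by
`IsPelczynskiUniversal.exists_not_isSchreierStrictlySingular` no countable ordinal bounds
them. -/
theorem IsPelczynskiUniversal.strictlySingularIndex_eq (hU : IsPelczynskiUniversal U)
    (ha : IsSchreierChoice a)
    (h : ∀ T : U →L[ℝ] U, IsStrictlySingular T →
      ∃ ξ : Ordinal.{0}, 1 ≤ ξ ∧ ξ < ω₁ ∧ IsSchreierStrictlySingular a ξ T) :
    strictlySingularIndex U U a = ω₁ := by
  have hrank : ∀ T : {T : U →L[ℝ] U // IsStrictlySingular T},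
      strictlySingularRank a T.1 < ω₁ ∧
        IsSchreierStrictlySingular a (strictlySingularRank a T.1) T.1 := fun T =>
    (csInf_mem (s := {ξ | 1 ≤ ξ ∧ ξ < ω₁ ∧ IsSchreierStrictlySingular a ξ T.1}) (h T.1 T.2)).2
  refine le_antisymm (ciSup_le' fun T => (hrank T).1.le) (not_lt.1 fun hlt => ?_)
  obtain ⟨T, hT, hTξ⟩ := hU.exists_not_isSchreierStrictlySingular ha hlt
  refine hTξ _ ?_ (hrank ⟨T, hT⟩).2
  exact le_ciSup (f := fun T : {T : U →L[ℝ] U // IsStrictlySingular T} =>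
    strictlySingularRank a T.1) ⟨ω₁, by rintro _ ⟨S, rfl⟩; exact (hrank S).1.le⟩ ⟨T, hT⟩

end Columns

theorem mainTheorem4 :
    IsPelczynskiUniversal PelczynskiSpace ∧
    ∀ (U : Type*) [NormedAddCommGroup U] [NormedSpace ℝ U] [CompleteSpace U],
      IsPelczynskiUniversal U →
      (∀ a : Ordinal.{0} → ℕ → Ordinal.{0}, IsSchreierChoice a →
        (∀ T : U →L[ℝ] U, IsStrictlySingular T →
          ∃ ξ : Ordinal.{0}, 1 ≤ ξ ∧ ξ < ω₁ ∧ IsSchreierStrictlySingular a ξ T) ∧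
        strictlySingularIndex U U a = ω₁) ∧
      MeasureTheory.AnalyticSet (strictlySingularBall U U)ᶜ ∧
      ¬ @MeasurableSet (OperatorBall U U) (borel (OperatorBall U U)) (strictlySingularBall U U) := by
  refine ⟨isPelczynskiUniversal_pelczynskiSpace, fun U _ _ _ hU => ?_⟩
  have : TopologicalSpace.SeparableSpace U := hU.choose.separableSpace
  refine ⟨fun a ha => ?_, analyticSet_compl_strictlySingularBall,
    hU.not_measurableSet_strictlySingularBall⟩
  have h : ∀ T : U →L[ℝ] U, IsStrictlySingular T →
      ∃ ξ : Ordinal.{0}, 1 ≤ ξ ∧ ξ < ω₁ ∧ IsSchreierStrictlySingular a ξ T := fun T hT =>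
    exists_isSchreierStrictlySingular ha hT
  exact ⟨h, hU.strictlySingularIndex_eq ha h⟩
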